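/- Let $\mathbb{K}$ be a field of characteristic $0$ and let $q\in\mathbb{K}^*$ not be a root of unity. Let $U=U_q(\mathfrak{sl}_4^+)$ be the unital associative $\mathbb{K}$-algebra with generators $e_1,e_2,e_3$ and relations $e_1e_3=e_3e_1$ and $e_i^2e_j-(q+q^{-1})e_ie_je_i+e_je_i^2=0$ whenever $|i-j|=1$, graded by $\deg e_i=1$. Put $X_2=e_1e_2-q^{-1}e_2e_1$, $X_4=e_2$, $X_5=e_2e_3-q^{-1}e_3e_2$, $X_3=e_1X_5-q^{-1}X_5e_1$ and $$z_2=\Delta_2=X_2X_5-qX_3X_4 .$$ Then $\Delta_2$ is a nonzero central element of $U$, homogeneous of degree $4$, and for every $\mathbb{K}$-linear derivation $D$ of $U$ there is an element $z$ of the center of $U$ such that $D(z_2)=z\,z_2$. In particular, every $\mathbb{K}$-linear derivation of $U$ maps the two-sided ideal generated by $\Delta_2$ into itself. -/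

import Mathlib

/-- The defining relations of `U_q(sl_4^+)` on the free algebra in three generators `e_1, e_2, e_3`
(indexed here by `0, 1, 2 : Fin 3`): `e_1 e_3 = e_3 e_1`, and the quantum Serre relations
`e_i ^ 2 e_j - (q + q⁻¹) e_i e_j e_i + e_j e_i ^ 2 = 0` for `|i - j| = 1`. -/
inductive QuantumSerreRel (K : Type*) [Field K] (q : K) :
    FreeAlgebra K (Fin 3) → FreeAlgebra K (Fin 3) → Prop
  | comm : QuantumSerreRel K q
      (FreeAlgebra.ι K 0 * FreeAlgebra.ι K 2 - FreeAlgebra.ι K 2 * FreeAlgebra.ι K 0) 0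
  | serre (i j : Fin 3) (hij : i.val + 1 = j.val ∨ j.val + 1 = i.val) : QuantumSerreRel K q
      (FreeAlgebra.ι K i ^ 2 * FreeAlgebra.ι K j
        - (q + q⁻¹) • (FreeAlgebra.ι K i * FreeAlgebra.ι K j * FreeAlgebra.ι K i)
        + FreeAlgebra.ι K j * FreeAlgebra.ι K i ^ 2) 0

/-- The unital associative `K`-algebra `U_q(sl_4^+)`. -/
abbrev UqSl4Plus (K : Type*) [Field K] (q : K) : Type _ := RingQuot (QuantumSerreRel K q)

namespace UqSl4Plus

variable (K : Type*) [Field K] (q : K)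

/-- The generators: `e K q 0`, `e K q 1`, `e K q 2` are `e_1`, `e_2`, `e_3`. -/
def e (i : Fin 3) : UqSl4Plus K q :=
  RingQuot.mkAlgHom K (QuantumSerreRel K q) (FreeAlgebra.ι K i)

/-- `X_2 = e_1 e_2 - q⁻¹ e_2 e_1`. -/
def X2 : UqSl4Plus K q := e K q 0 * e K q 1 - q⁻¹ • (e K q 1 * e K q 0)

/-- `X_4 = e_2`. -/
def X4 : UqSl4Plus K q := e K q 1

/-- `X_5 = e_2 e_3 - q⁻¹ e_3 e_2`. -/
def X5 : UqSl4Plus K q := e K q 1 * e K q 2 - q⁻¹ • (e K q 2 * e K q 1)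

/-- `X_3 = e_1 X_5 - q⁻¹ X_5 e_1`. -/
def X3 : UqSl4Plus K q := e K q 0 * X5 K q - q⁻¹ • (X5 K q * e K q 0)

/-- `z_2 = Δ_2 = X_2 X_5 - q X_3 X_4`. -/
def Delta2 : UqSl4Plus K q := X2 K q * X5 K q - q • (X3 K q * X4 K q)

/-- The homogeneous component of degree `n` for the `ℕ`-grading in which each `e_i` has degree `1`:
the linear span of the products of `n` generators. -/
def homogeneousPart (n : ℕ) : Submodule K (UqSl4Plus K q) :=
  Submodule.span K (Set.range (e K q)) ^ n

end UqSl4Plus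

/-- A `K`-linear endomorphism `D` of a (not necessarily commutative) `K`-algebra is a derivation
if it satisfies the Leibniz rule. -/
def IsAlgDerivation {K A : Type*} [Field K] [Ring A] [Algebra K A] (D : A →ₗ[K] A) : Prop :=
  ∀ a b : A, D (a * b) = D a * b + a * D b

/-!
The argument embeds `U = U_q(sl_4^+)` into a quantum torus in which `Δ_2` becomes, up to a scalar, a
central variable `X` that is not inverted. Let `g`, `g'` generate `ℤ²`, acting on the Laurent
polynomials in `k`, `w`, `w'` by powers of `q` and fixing `X`. Then
`e_1 ↦ k⁻¹ (g + g')`, `e_2 ↦ k`, `e_3 ↦ ((X + w) g⁻¹ + (q ^ 2 X + w') g'⁻¹) k⁻¹`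
defines a homomorphism `toTorus` to the skew group ring, with `X_2 ↦ ν g`, `X_5 ↦ ν (X + w) g⁻¹`,
`X_3 X_4 ↦ ν ^ 2 q w` and `Δ_2 ↦ ν ^ 2 X`, where `ν = q - q⁻¹`.

The algebra `U` is spanned by the monomials
`e_1 ^ a (X_2 or X_5) ^ b X_3 ^ c X_4 ^ d Δ_2 ^ i e_3 ^ f` (`mem_span_pbw`), and their images have
distinct leading monomials (`hasLead_toTorus_pbw`, `leadExponent_injective`). Hence `toTorus` is
injective, which makes `Δ_2` central, nonzero and cancellable, and an element of `U` whose image is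
divisible by `X` is divisible by `Δ_2` (`exists_eq_Delta2_mul`).

For a derivation `D`, the element `D(Δ_2)` is central, so its image is a polynomial `d` in `X` fixed
by the group. Put `W = X_3 X_4` and let `h` be the coefficient of the image of `D(W)` at `1 ∈ ℤ²`.
The relation `X_2 W = q ^ 2 W X_2` gives `g • h = q ^ 2 h`. The relation `X_5 X_2 = Δ_2 + q⁻¹ W`
gives `X + w ∣ d + q⁻¹ h`, because in the image of `U` the inverse of `g` only occurs together with
the factor `X + w` (`XAddW_dvd_coeff_toTorus`). So `w d - q⁻¹ h X` is divisible by `X + w` and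
semi-invariant under the group, hence divisible by `X + q ^ (2 n) w` for all `n`. It therefore
vanishes, `q` not being a root of unity, and `X` divides `d` (`X_dvd_of_XAddW_dvd`). This yields
`D(Δ_2) = z Δ_2`, and `z` is central since `Δ_2` can be cancelled.
-/

/-! ### Commutation relations between the root vectors -/

namespace UqSl4Plus

section Relations

variable {K : Type*} [Field K] {q : K}

theorem e_zero_mul_e_two : e K q 0 * e K q 2 = e K q 2 * e K q 0 := by
  have h := RingQuot.mkAlgHom_rel K (QuantumSerreRel.comm (K := K) (q := q))
  simp only [map_sub, map_mul, map_zero, sub_eq_zero] at h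
  exact h

theorem serre (i j : Fin 3) (hij : i.val + 1 = j.val ∨ j.val + 1 = i.val) :
    e K q i * (e K q i * e K q j) - (q + q⁻¹) • (e K q i * (e K q j * e K q i))
      + e K q j * (e K q i * e K q i) = 0 := by
  have h := RingQuot.mkAlgHom_rel K (QuantumSerreRel.serre (K := K) (q := q) i j hij)
  simp only [map_sub, map_add, map_smul, map_mul, map_zero, pow_two, mul_assoc] at h
  exact h

theorem X4_mul_e_zero (hq : q ≠ 0) :
    X4 K q * e K q 0 = q • (e K q 0 * X4 K q) - q • X2 K q := by
  simp only [X2, X4, smul_sub, smul_smul, mul_inv_cancel₀ hq, one_smul]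
  abel

theorem X5_mul_e_zero (hq : q ≠ 0) :
    X5 K q * e K q 0 = q • (e K q 0 * X5 K q) - q • X3 K q := by
  simp only [X3, smul_sub, smul_smul, mul_inv_cancel₀ hq, one_smul]
  abel

theorem e_two_mul_X4 (hq : q ≠ 0) :
    e K q 2 * X4 K q = q • (X4 K q * e K q 2) - q • X5 K q := by
  simp only [X5, X4, smul_sub, smul_smul, mul_inv_cancel₀ hq, one_smul]
  abel

theorem X2_mul_e_zero (hq : q ≠ 0) : X2 K q * e K q 0 = q⁻¹ • (e K q 0 * X2 K q) := by
  have h := serre (K := K) (q := q) 0 1 (by decide)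
  simp only [X2, mul_sub, sub_mul, mul_smul_comm, smul_mul_assoc, mul_assoc]
  linear_combination (norm := skip) (-q⁻¹) • h
  match_scalars <;> field_simp <;> ring

theorem X2_mul_X4 (hq : q ≠ 0) : X2 K q * X4 K q = q • (X4 K q * X2 K q) := by
  have h := serre (K := K) (q := q) 1 0 (by decide)
  simp only [X2, X4, mul_sub, sub_mul, mul_smul_comm, smul_mul_assoc, mul_assoc]
  linear_combination (norm := skip) h
  match_scalars <;> field_simp <;> ring

theorem X5_mul_X4 (hq : q ≠ 0) : X5 K q * X4 K q = q⁻¹ • (X4 K q * X5 K q) := by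
  have h := serre (K := K) (q := q) 1 2 (by decide)
  simp only [X5, X4, mul_sub, sub_mul, mul_smul_comm, smul_mul_assoc, mul_assoc]
  linear_combination (norm := skip) (-q⁻¹) • h
  match_scalars <;> field_simp <;> ring

theorem e_two_mul_X5 (hq : q ≠ 0) : e K q 2 * X5 K q = q⁻¹ • (X5 K q * e K q 2) := by
  have h := serre (K := K) (q := q) 2 1 (by decide)
  simp only [X5, mul_sub, sub_mul, mul_smul_comm, smul_mul_assoc, mul_assoc]
  linear_combination (norm := skip) (-q⁻¹) • h
  match_scalars <;> field_simp <;> ring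

theorem e_two_mul_X2 (hq : q ≠ 0) :
    e K q 2 * X2 K q = q • (X2 K q * e K q 2) - q • X3 K q := by
  have h : e K q 2 * e K q 0 = e K q 0 * e K q 2 := e_zero_mul_e_two.symm
  have h' (x : UqSl4Plus K q) : e K q 2 * (e K q 0 * x) = e K q 0 * (e K q 2 * x) := by
    rw [← mul_assoc, h, mul_assoc]
  simp only [X5, X2, X3, mul_sub, sub_mul, mul_smul_comm, smul_mul_assoc, mul_assoc, h, h']
  match_scalars <;> field_simp <;> ring

theorem X3_mul_e_zero (hq : q ≠ 0) : X3 K q * e K q 0 = q⁻¹ • (e K q 0 * X3 K q) := by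
  have h3 : X3 K q = X2 K q * e K q 2 - q⁻¹ • (e K q 2 * X2 K q) := by
    rw [e_two_mul_X2 hq]
    match_scalars <;> field_simp
    ring
  have h : e K q 2 * e K q 0 = e K q 0 * e K q 2 := e_zero_mul_e_two.symm
  have h' (x : UqSl4Plus K q) : e K q 2 * (e K q 0 * x) = e K q 0 * (e K q 2 * x) := by
    rw [← mul_assoc, h, mul_assoc]
  have h2 (x : UqSl4Plus K q) : X2 K q * (e K q 0 * x) = q⁻¹ • (e K q 0 * (X2 K q * x)) := by
    rw [← mul_assoc, X2_mul_e_zero hq, smul_mul_assoc, mul_assoc]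
  simp only [h3, mul_sub, sub_mul, mul_smul_comm, smul_mul_assoc, mul_assoc, h, h', h2,
    X2_mul_e_zero hq]
  match_scalars <;> field_simp

theorem e_two_mul_X3 (hq : q ≠ 0) : e K q 2 * X3 K q = q⁻¹ • (X3 K q * e K q 2) := by
  have h : e K q 2 * e K q 0 = e K q 0 * e K q 2 := e_zero_mul_e_two.symm
  have h' (x : UqSl4Plus K q) : e K q 2 * (e K q 0 * x) = e K q 0 * (e K q 2 * x) := by
    rw [← mul_assoc, h, mul_assoc]
  have h2 (x : UqSl4Plus K q) : e K q 2 * (X5 K q * x) = q⁻¹ • (X5 K q * (e K q 2 * x)) := by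
    rw [← mul_assoc, e_two_mul_X5 hq, smul_mul_assoc, mul_assoc]
  simp only [X3, mul_sub, sub_mul, mul_smul_comm, smul_mul_assoc, mul_assoc, h, h', h2,
    e_two_mul_X5 hq, smul_sub]

/-- Computing `X_4 X_3` and `X_3 X_4` from the two expressions of `X_3` as a `q`-commutator gives
two relations with the commutator of `X_2` and `X_5`; both conclusions follow from them. -/
theorem X3_X4_relations (hq : q ≠ 0) (hq2 : q ^ 2 + 1 ≠ 0) :
    X3 K q * X4 K q = X4 K q * X3 K q ∧
      X5 K q * X2 K q = X2 K q * X5 K q - (q - q⁻¹) • (X3 K q * X4 K q) := by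
  have h3 : X3 K q = X2 K q * e K q 2 - q⁻¹ • (e K q 2 * X2 K q) := by
    rw [e_two_mul_X2 hq]
    match_scalars <;> field_simp
    ring
  have hA : X4 K q * X3 K q - (q⁻¹ * q⁻¹) • (X3 K q * X4 K q)
      = q⁻¹ • (X2 K q * X5 K q - X5 K q * X2 K q) := by
    have a1 (x : UqSl4Plus K q) : X4 K q * (X2 K q * x) = q⁻¹ • (X2 K q * (X4 K q * x)) := by
      rw [← mul_assoc, ← mul_assoc, X2_mul_X4 hq, smul_mul_assoc, smul_smul,
        inv_mul_cancel₀ hq, one_smul]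
    have a2 : X2 K q * X4 K q = q • (X4 K q * X2 K q) := X2_mul_X4 hq
    rw [h3]
    simp only [mul_sub, sub_mul, mul_smul_comm, smul_mul_assoc, mul_assoc, a1, a2]
    simp only [X5, X4, mul_sub, sub_mul, mul_smul_comm, smul_mul_assoc, mul_assoc]
    match_scalars <;> field_simp
  have hB : X3 K q * X4 K q - (q⁻¹ * q⁻¹) • (X4 K q * X3 K q)
      = q⁻¹ • (X2 K q * X5 K q - X5 K q * X2 K q) := by
    have a1 (x : UqSl4Plus K q) : X4 K q * (X5 K q * x) = q • (X5 K q * (X4 K q * x)) := by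
      rw [← mul_assoc, ← mul_assoc, X5_mul_X4 hq, smul_mul_assoc, smul_smul,
        mul_inv_cancel₀ hq, one_smul]
    have a2 : X5 K q * X4 K q = q⁻¹ • (X4 K q * X5 K q) := X5_mul_X4 hq
    simp only [X3, mul_sub, sub_mul, mul_smul_comm, smul_mul_assoc, mul_assoc, a1, a2]
    simp only [X2, X4, mul_sub, sub_mul, mul_smul_comm, smul_mul_assoc, mul_assoc]
    match_scalars <;> field_simp
  have hcomm : X3 K q * X4 K q = X4 K q * X3 K q := by
    have h1 : (1 + q⁻¹ * q⁻¹) • (X3 K q * X4 K q - X4 K q * X3 K q) = 0 := by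
      linear_combination (norm := module) hB - hA
    have h2 : (1 + q⁻¹ * q⁻¹) ≠ 0 := by
      intro h
      have h' : q ^ 2 * (1 + q⁻¹ * q⁻¹) = q ^ 2 + 1 := by field_simp
      rw [h, mul_zero] at h'
      exact hq2 h'.symm
    exact sub_eq_zero.1 ((smul_eq_zero.1 h1).resolve_left h2)
  refine ⟨hcomm, ?_⟩
  rw [← hcomm] at hA
  linear_combination (norm := skip) q • hA
  match_scalars <;> field_simp <;> ring

theorem X3_mul_X4 (hq : q ≠ 0) (hq2 : q ^ 2 + 1 ≠ 0) :
    X3 K q * X4 K q = X4 K q * X3 K q := (X3_X4_relations hq hq2).1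

theorem X2_mul_X5 : X2 K q * X5 K q = Delta2 K q + q • (X3 K q * X4 K q) := by
  simp [Delta2]

theorem X5_mul_X2 (hq : q ≠ 0) (hq2 : q ^ 2 + 1 ≠ 0) :
    X5 K q * X2 K q = Delta2 K q + q⁻¹ • (X3 K q * X4 K q) := by
  rw [(X3_X4_relations hq hq2).2, Delta2]
  module

/-- This is `X_3 X_4 = X_4 X_3` commuted with `e_1`. -/
theorem X2_mul_X3 (hq : q ≠ 0) (hq2 : q ^ 2 + 1 ≠ 0) :
    X2 K q * X3 K q = q • (X3 K q * X2 K q) := by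
  have h : X3 K q * (X4 K q * e K q 0) = X4 K q * (X3 K q * e K q 0) := by
    rw [← mul_assoc, X3_mul_X4 hq hq2, mul_assoc]
  have h2 (x : UqSl4Plus K q) : X3 K q * (e K q 0 * x) = q⁻¹ • (e K q 0 * (X3 K q * x)) := by
    rw [← mul_assoc, X3_mul_e_zero hq, smul_mul_assoc, mul_assoc]
  have h4 (x : UqSl4Plus K q) : X4 K q * (e K q 0 * x)
      = q • (e K q 0 * (X4 K q * x)) - q • (X2 K q * x) := by
    rw [← mul_assoc, X4_mul_e_zero hq, sub_mul, smul_mul_assoc, smul_mul_assoc, mul_assoc]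
  rw [X4_mul_e_zero hq, X3_mul_e_zero hq, mul_sub, mul_smul_comm, mul_smul_comm, mul_smul_comm,
    h2, h4, X3_mul_X4 hq hq2] at h
  linear_combination (norm := skip) h
  match_scalars <;> field_simp <;> ring

/-- This is `X_3 X_4 = X_4 X_3` commuted with `e_3`. -/
theorem X5_mul_X3 (hq : q ≠ 0) (hq2 : q ^ 2 + 1 ≠ 0) :
    X5 K q * X3 K q = q⁻¹ • (X3 K q * X5 K q) := by
  have h : e K q 2 * (X3 K q * X4 K q) = e K q 2 * (X4 K q * X3 K q) := by rw [X3_mul_X4 hq hq2]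
  have h2 (x : UqSl4Plus K q) : e K q 2 * (X3 K q * x) = q⁻¹ • (X3 K q * (e K q 2 * x)) := by
    rw [← mul_assoc, e_two_mul_X3 hq, smul_mul_assoc, mul_assoc]
  have h4 (x : UqSl4Plus K q) : e K q 2 * (X4 K q * x)
      = q • (X4 K q * (e K q 2 * x)) - q • (X5 K q * x) := by
    rw [← mul_assoc, e_two_mul_X4 hq, sub_mul, smul_mul_assoc, smul_mul_assoc, mul_assoc]
  have h5 (x : UqSl4Plus K q) : X3 K q * (X4 K q * x) = X4 K q * (X3 K q * x) := by
    rw [← mul_assoc, X3_mul_X4 hq hq2, mul_assoc]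
  simp only [e_two_mul_X4 hq, e_two_mul_X3 hq, mul_sub, mul_smul_comm, h2, h4, h5] at h
  linear_combination (norm := skip) q⁻¹ • h
  match_scalars <;> field_simp <;> ring

end Relations

end UqSl4Plus

/-! ### A spanning set of ordered monomials -/

section Spanning

theorem pow_mul_of_mul_eq_smul_mul {K A : Type*} [Field K] [Ring A] [Algebra K A] {a b : A} {c : K}
    (h : a * b = c • (b * a)) (n : ℕ) : a ^ n * b = c ^ n • (b * a ^ n) := by
  induction n with
  | zero => simp
  | succ n ih =>
    rw [pow_succ, mul_assoc, h, mul_smul_comm, ← mul_assoc, ih, smul_mul_assoc, smul_smul,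
      mul_assoc, pow_succ, mul_comm (c ^ n)]

/-- A subspace that contains `1` and is stable under right multiplication by a set contains the
subalgebra generated by that set. -/
theorem adjoin_le_of_mul_mem {K A : Type*} [Field K] [Ring A] [Algebra K A] {s : Set A}
    {P : Submodule K A} (h1 : 1 ∈ P) (h : ∀ p ∈ P, ∀ a ∈ s, p * a ∈ P) {a : A}
    (ha : a ∈ Algebra.adjoin K s) : a ∈ P := by
  suffices ∀ p ∈ P, p * a ∈ P by simpa using this 1 h1
  induction ha using Algebra.adjoin_induction with
  | mem x hx => exact fun p hp => h p hp x hx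
  | algebraMap r =>
    intro p hp
    rw [← Algebra.commutes, ← Algebra.smul_def]
    exact P.smul_mem r hp
  | add x y _ _ hx hy =>
    intro p hp
    rw [mul_add]
    exact P.add_mem (hx p hp) (hy p hp)
  | mul x y _ _ hx hy =>
    intro p hp
    rw [← mul_assoc]
    exact hy _ (hx p hp)

/-- If the generators of a subalgebra `S` satisfy `a x ∈ x S + S`, then so do all its elements. -/
theorem exists_mul_eq_of_mem_adjoin {K A : Type*} [Field K] [Ring A] [Algebra K A] {s : Set A}
    {x : A} (h : ∀ a ∈ s, ∃ b ∈ Algebra.adjoin K s, ∃ c ∈ Algebra.adjoin K s, a * x = x * b + c)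
    {a : A} (ha : a ∈ Algebra.adjoin K s) :
    ∃ b ∈ Algebra.adjoin K s, ∃ c ∈ Algebra.adjoin K s, a * x = x * b + c := by
  induction ha using Algebra.adjoin_induction with
  | mem a ha => exact h a ha
  | algebraMap r =>
    exact ⟨algebraMap K A r, Subalgebra.algebraMap_mem _ r, 0, zero_mem _, by
      rw [Algebra.commutes, add_zero]⟩
  | add a a' _ _ iha iha' =>
    obtain ⟨b, hb, c, hc, e⟩ := iha
    obtain ⟨b', hb', c', hc', e'⟩ := iha'
    exact ⟨b + b', add_mem hb hb', c + c', add_mem hc hc', by rw [add_mul, e, e']; noncomm_ring⟩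
  | mul a a' ha _ iha iha' =>
    obtain ⟨b, hb, c, hc, e⟩ := iha
    obtain ⟨b', hb', c', hc', e'⟩ := iha'
    refine ⟨b * b', mul_mem hb hb', c * b' + a * c', add_mem (mul_mem hc hb') (mul_mem ha hc'), ?_⟩
    rw [mul_assoc, e', mul_add, ← mul_assoc, e]
    noncomm_ring

/-- If the generators of a subalgebra `S` satisfy `x a ∈ S x + S`, then so do all its elements. -/
theorem exists_eq_mul_of_mem_adjoin {K A : Type*} [Field K] [Ring A] [Algebra K A] {s : Set A}
    {x : A} (h : ∀ a ∈ s, ∃ b ∈ Algebra.adjoin K s, ∃ c ∈ Algebra.adjoin K s, x * a = b * x + c)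
    {a : A} (ha : a ∈ Algebra.adjoin K s) :
    ∃ b ∈ Algebra.adjoin K s, ∃ c ∈ Algebra.adjoin K s, x * a = b * x + c := by
  induction ha using Algebra.adjoin_induction with
  | mem a ha => exact h a ha
  | algebraMap r =>
    exact ⟨algebraMap K A r, Subalgebra.algebraMap_mem _ r, 0, zero_mem _, by
      rw [Algebra.commutes, add_zero]⟩
  | add a a' _ _ iha iha' =>
    obtain ⟨b, hb, c, hc, e⟩ := iha
    obtain ⟨b', hb', c', hc', e'⟩ := iha'
    exact ⟨b + b', add_mem hb hb', c + c', add_mem hc hc', by rw [mul_add, e, e']; noncomm_ring⟩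
  | mul a a' _ ha' iha iha' =>
    obtain ⟨b, hb, c, hc, e⟩ := iha
    obtain ⟨b', hb', c', hc', e'⟩ := iha'
    refine ⟨b * b', mul_mem hb hb', b * c' + c * a', add_mem (mul_mem hb hc') (mul_mem hc ha'), ?_⟩
    rw [← mul_assoc, e, add_mul, mul_assoc, e']
    noncomm_ring

end Spanning

namespace UqSl4Plus

section PBW

variable {K : Type*} [Field K] {q : K}

theorem adjoin_range_e : Algebra.adjoin K (Set.range (e K q)) = ⊤ := by
  have h : Set.range (e K q)
      = RingQuot.mkAlgHom K (QuantumSerreRel K q) '' Set.range (FreeAlgebra.ι K) := by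
    rw [← Set.range_comp]; rfl
  rw [h, ← AlgHom.map_adjoin, FreeAlgebra.adjoin_range_ι, Algebra.map_top, AlgHom.range_eq_top]
  exact RingQuot.mkAlgHom_surjective K _

/-- A subspace of `U` containing `1` and stable under right multiplication by the generators is
everything. -/
theorem mem_of_mul_e_mem {P : Submodule K (UqSl4Plus K q)} (h1 : 1 ∈ P)
    (h : ∀ p ∈ P, ∀ i, p * e K q i ∈ P) (a : UqSl4Plus K q) : a ∈ P := by
  have ha : a ∈ Algebra.adjoin K (Set.range (e K q)) := by
    rw [adjoin_range_e]; exact Algebra.mem_top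
  exact adjoin_le_of_mul_mem h1 (by rintro p hp _ ⟨i, rfl⟩; exact h p hp i) ha

theorem commute_Delta2_X4 (hq : q ≠ 0) (hq2 : q ^ 2 + 1 ≠ 0) :
    Commute (Delta2 K q) (X4 K q) := by
  rw [Delta2]
  refine Commute.sub_left ?_ (Commute.smul_left ?_ _)
  · rw [commute_iff_eq, mul_assoc, X5_mul_X4 hq, mul_smul_comm, ← mul_assoc, X2_mul_X4 hq,
      smul_mul_assoc, smul_smul, inv_mul_cancel₀ hq, one_smul, mul_assoc]
  · exact Commute.mul_left (X3_mul_X4 hq hq2) (Commute.refl _)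

theorem commute_Delta2_X3 (hq : q ≠ 0) (hq2 : q ^ 2 + 1 ≠ 0) :
    Commute (Delta2 K q) (X3 K q) := by
  rw [Delta2]
  refine Commute.sub_left ?_ (Commute.smul_left ?_ _)
  · rw [commute_iff_eq, mul_assoc, X5_mul_X3 hq hq2, mul_smul_comm, ← mul_assoc, X2_mul_X3 hq hq2,
      smul_mul_assoc, smul_smul, inv_mul_cancel₀ hq, one_smul, mul_assoc]
  · exact Commute.mul_left (Commute.refl _) (X3_mul_X4 hq hq2).symm

theorem X2_mul_X3_mul_X4 (hq : q ≠ 0) (hq2 : q ^ 2 + 1 ≠ 0) :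
    X2 K q * (X3 K q * X4 K q) = q ^ 2 • (X3 K q * X4 K q * X2 K q) := by
  rw [← mul_assoc, X2_mul_X3 hq hq2, smul_mul_assoc, mul_assoc, X2_mul_X4 hq, mul_smul_comm,
    smul_smul, ← mul_assoc, pow_two]

theorem X3_mul_X4_mul_X5 (hq : q ≠ 0) (hq2 : q ^ 2 + 1 ≠ 0) :
    X3 K q * X4 K q * X5 K q = q ^ 2 • (X5 K q * (X3 K q * X4 K q)) := by
  rw [← mul_assoc, X5_mul_X3 hq hq2, smul_mul_assoc, mul_assoc _ (X5 K q), X5_mul_X4 hq,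
    mul_smul_comm, smul_smul, smul_smul, ← mul_assoc]
  match_scalars; field_simp

theorem commute_Delta2_X2 (hq : q ≠ 0) (hq2 : q ^ 2 + 1 ≠ 0) :
    Commute (Delta2 K q) (X2 K q) := by
  have h1 : Delta2 K q * X2 K q
      = X2 K q * (X5 K q * X2 K q) - q • (X3 K q * X4 K q * X2 K q) := by
    rw [Delta2, sub_mul, mul_assoc (X2 K q), smul_mul_assoc]
  have h2 := X2_mul_X3_mul_X4 hq hq2
  rw [commute_iff_eq, h1, X5_mul_X2 hq hq2, mul_add, mul_smul_comm, h2, smul_smul]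
  match_scalars <;> field_simp
  ring

theorem commute_Delta2_X5 (hq : q ≠ 0) (hq2 : q ^ 2 + 1 ≠ 0) :
    Commute (Delta2 K q) (X5 K q) := by
  have h1 : Delta2 K q * X5 K q
      = (X5 K q * X2 K q - q⁻¹ • (X3 K q * X4 K q)) * X5 K q := by
    rw [X5_mul_X2 hq hq2, add_sub_cancel_right]
  have h2 := X3_mul_X4_mul_X5 hq hq2
  rw [commute_iff_eq, h1, sub_mul, mul_assoc, X2_mul_X5, mul_add, smul_mul_assoc, h2,
    mul_smul_comm, smul_smul]
  match_scalars <;> field_simp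
  ring

variable (K q) in
/-- The powers of `X_2` (nonnegative index) and of `X_5` (negative index), as one `ℤ`-indexed
family. -/
def X2X5Pow : ℤ → UqSl4Plus K q
  | .ofNat n => X2 K q ^ n
  | .negSucc n => X5 K q ^ (n + 1)

variable (K q) in
/-- The monomials `X_2 ^ b X_3 ^ c X_4 ^ d Δ_2 ^ i` and `X_5 ^ b X_3 ^ c X_4 ^ d Δ_2 ^ i`. -/
def midMonomial (b : ℤ) (c d i : ℕ) : UqSl4Plus K q :=
  X2X5Pow K q b * X3 K q ^ c * X4 K q ^ d * Delta2 K q ^ i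

variable (K q) in
/-- The linear span of the monomials `midMonomial`. -/
def midSpan : Submodule K (UqSl4Plus K q) :=
  Submodule.span K (Set.range fun p : ℤ × ℕ × ℕ × ℕ => midMonomial K q p.1 p.2.1 p.2.2.1 p.2.2.2)

theorem midMonomial_mem (b : ℤ) (c d i : ℕ) : midMonomial K q b c d i ∈ midSpan K q :=
  Submodule.subset_span ⟨(b, c, d, i), rfl⟩

theorem midMonomial_mul_X4 (hq : q ≠ 0) (hq2 : q ^ 2 + 1 ≠ 0) (b : ℤ) (c d i : ℕ) :
    midMonomial K q b c d i * X4 K q = midMonomial K q b c (d + 1) i := by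
  rw [midMonomial, midMonomial, mul_assoc, ((commute_Delta2_X4 hq hq2).pow_left i).eq, pow_succ]
  simp only [mul_assoc]

theorem midMonomial_mul_X3 (hq : q ≠ 0) (hq2 : q ^ 2 + 1 ≠ 0) (b : ℤ) (c d i : ℕ) :
    midMonomial K q b c d i * X3 K q = midMonomial K q b (c + 1) d i := by
  have h : Commute (X4 K q) (X3 K q) := (X3_mul_X4 hq hq2).symm
  rw [midMonomial, midMonomial, mul_assoc, ((commute_Delta2_X3 hq hq2).pow_left i).eq,
    ← mul_assoc, mul_assoc _ (X4 K q ^ d), (h.pow_left d).eq, pow_succ]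
  simp only [mul_assoc]

theorem X2X5Pow_mul_add_mem (hq : q ≠ 0) (hq2 : q ^ 2 + 1 ≠ 0) (r : K) (b : ℤ) (c d i : ℕ) :
    X2X5Pow K q b * (Delta2 K q + r • (X3 K q * X4 K q)) * X3 K q ^ c * X4 K q ^ d * Delta2 K q ^ i
      ∈ midSpan K q := by
  have h4 : Commute (X4 K q) (X3 K q) := (X3_mul_X4 hq hq2).symm
  have e : X2X5Pow K q b * (Delta2 K q + r • (X3 K q * X4 K q)) * X3 K q ^ c * X4 K q ^ d
        * Delta2 K q ^ i
      = midMonomial K q b c d (i + 1) + r • midMonomial K q b (c + 1) (d + 1) i := by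
    simp only [midMonomial, mul_add, add_mul, mul_smul_comm, smul_mul_assoc]
    refine congrArg₂ (· + ·) ?_ (congrArg (r • ·) ?_)
    · rw [mul_assoc _ (Delta2 K q), ((commute_Delta2_X3 hq hq2).pow_right c).eq, ← mul_assoc,
        mul_assoc _ (Delta2 K q), ((commute_Delta2_X4 hq hq2).pow_right d).eq, pow_succ']
      simp only [mul_assoc]
    · rw [mul_assoc _ _ (X3 K q ^ c), mul_assoc (X3 K q), (h4.pow_right c).eq, pow_succ', pow_succ']
      simp only [mul_assoc]
  rw [e]
  exact add_mem (midMonomial_mem _ _ _ _) (Submodule.smul_mem _ _ (midMonomial_mem _ _ _ _))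

theorem midMonomial_mul_X2_mem (hq : q ≠ 0) (hq2 : q ^ 2 + 1 ≠ 0) (b : ℤ) (c d i : ℕ) :
    midMonomial K q b c d i * X2 K q ∈ midSpan K q := by
  have h4 : X4 K q * X2 K q = q⁻¹ • (X2 K q * X4 K q) := by
    rw [X2_mul_X4 hq, smul_smul, inv_mul_cancel₀ hq, one_smul]
  have h3 : X3 K q * X2 K q = q⁻¹ • (X2 K q * X3 K q) := by
    rw [X2_mul_X3 hq hq2, smul_smul, inv_mul_cancel₀ hq, one_smul]
  have e : midMonomial K q b c d i * X2 K q = (q⁻¹ ^ d * q⁻¹ ^ c) •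
      (X2X5Pow K q b * X2 K q * X3 K q ^ c * X4 K q ^ d * Delta2 K q ^ i) := by
    rw [midMonomial, mul_assoc, ((commute_Delta2_X2 hq hq2).pow_left i).eq, ← mul_assoc,
      mul_assoc _ (X4 K q ^ d), pow_mul_of_mul_eq_smul_mul h4, mul_smul_comm, ← mul_assoc,
      mul_assoc _ (X3 K q ^ c) (X2 K q), pow_mul_of_mul_eq_smul_mul h3, mul_smul_comm]
    simp only [smul_mul_assoc, smul_smul, mul_assoc]
  rw [e]
  refine Submodule.smul_mem _ _ ?_
  rcases b with n | n
  · exact Submodule.subset_span ⟨(.ofNat (n + 1), c, d, i), by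
      simp only [midMonomial, X2X5Pow, pow_succ (X2 K q)]⟩
  · have h : X2X5Pow K q (.negSucc n) * X2 K q
        = X2X5Pow K q (-n) * (Delta2 K q + q⁻¹ • (X3 K q * X4 K q)) := by
      rw [← X5_mul_X2 hq hq2, ← mul_assoc]
      congr 1
      rcases n with _ | n
      · simp [X2X5Pow]
      · exact pow_succ _ _
    rw [h]
    exact X2X5Pow_mul_add_mem hq hq2 _ _ _ _ _

theorem midMonomial_mul_X5_mem (hq : q ≠ 0) (hq2 : q ^ 2 + 1 ≠ 0) (b : ℤ) (c d i : ℕ) :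
    midMonomial K q b c d i * X5 K q ∈ midSpan K q := by
  have h4 : X4 K q * X5 K q = q • (X5 K q * X4 K q) := by
    rw [X5_mul_X4 hq, smul_smul, mul_inv_cancel₀ hq, one_smul]
  have h3 : X3 K q * X5 K q = q • (X5 K q * X3 K q) := by
    rw [X5_mul_X3 hq hq2, smul_smul, mul_inv_cancel₀ hq, one_smul]
  have e : midMonomial K q b c d i * X5 K q = (q ^ d * q ^ c) •
      (X2X5Pow K q b * X5 K q * X3 K q ^ c * X4 K q ^ d * Delta2 K q ^ i) := by
    rw [midMonomial, mul_assoc, ((commute_Delta2_X5 hq hq2).pow_left i).eq, ← mul_assoc,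
      mul_assoc _ (X4 K q ^ d), pow_mul_of_mul_eq_smul_mul h4, mul_smul_comm, ← mul_assoc,
      mul_assoc _ (X3 K q ^ c) (X5 K q), pow_mul_of_mul_eq_smul_mul h3, mul_smul_comm]
    simp only [smul_mul_assoc, smul_smul, mul_assoc]
  rw [e]
  refine Submodule.smul_mem _ _ ?_
  rcases b with (_ | n) | n
  · exact Submodule.subset_span ⟨(.negSucc 0, c, d, i), by simp [midMonomial, X2X5Pow]⟩
  · have h : X2X5Pow K q (.ofNat (n + 1)) * X5 K q
        = X2X5Pow K q n * (Delta2 K q + q • (X3 K q * X4 K q)) := by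
      rw [← X2_mul_X5, ← mul_assoc]
      congr 1
      exact pow_succ _ _
    rw [h]
    exact X2X5Pow_mul_add_mem hq hq2 _ _ _ _ _
  · exact Submodule.subset_span ⟨(.negSucc (n + 1), c, d, i), by
      simp only [midMonomial, X2X5Pow, pow_succ (X5 K q)]⟩

theorem adjoin_le_midSpan (hq : q ≠ 0) (hq2 : q ^ 2 + 1 ≠ 0) {a : UqSl4Plus K q}
    (ha : a ∈ Algebra.adjoin K {X2 K q, X3 K q, X4 K q, X5 K q}) : a ∈ midSpan K q := by
  refine adjoin_le_of_mul_mem (P := midSpan K q) ?_ ?_ ha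
  · exact Submodule.subset_span ⟨(0, 0, 0, 0), by simp [midMonomial, X2X5Pow]⟩
  · intro p hp x hx
    induction hp using Submodule.span_induction with
    | mem p hp =>
      obtain ⟨⟨b, c, d, i⟩, rfl⟩ := hp
      rcases hx with rfl | rfl | rfl | rfl
      · exact midMonomial_mul_X2_mem hq hq2 b c d i
      · exact midMonomial_mul_X3 hq hq2 b c d i ▸ midMonomial_mem _ _ _ _
      · exact midMonomial_mul_X4 hq hq2 b c d i ▸ midMonomial_mem _ _ _ _
      · exact midMonomial_mul_X5_mem hq hq2 b c d i
    | zero => simp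
    | add a b _ _ ha hb => rw [add_mul]; exact add_mem ha hb
    | smul r a _ ha => rw [smul_mul_assoc]; exact Submodule.smul_mem _ _ ha

variable (K q) in
/-- The monomials `e_1 ^ a (X_2 or X_5) ^ b X_3 ^ c X_4 ^ d Δ_2 ^ i e_3 ^ f`, indexed by
`(a, b, c, d, i, f)`. They span `U`, by `mem_span_pbw`. -/
def pbw (p : ℕ × ℤ × ℕ × ℕ × ℕ × ℕ) : UqSl4Plus K q :=
  e K q 0 ^ p.1 * midMonomial K q p.2.1 p.2.2.1 p.2.2.2.1 p.2.2.2.2.1 * e K q 2 ^ p.2.2.2.2.2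

/-- The subalgebra generated by `X_2, …, X_5` can be moved past `e_1` and `e_3`, which turns any
word in the generators into a combination of ordered monomials. -/
theorem mem_span_pbw (hq : q ≠ 0) (hq2 : q ^ 2 + 1 ≠ 0) (x : UqSl4Plus K q) :
    x ∈ Submodule.span K (Set.range (pbw K q)) := by
  set s : Set (UqSl4Plus K q) := {X2 K q, X3 K q, X4 K q, X5 K q} with hs
  set N := Algebra.adjoin K s with hN
  have m2 : X2 K q ∈ N := Algebra.subset_adjoin (by simp [hs])
  have m3 : X3 K q ∈ N := Algebra.subset_adjoin (by simp [hs])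
  have m4 : X4 K q ∈ N := Algebra.subset_adjoin (by simp [hs])
  have m5 : X5 K q ∈ N := Algebra.subset_adjoin (by simp [hs])
  have hleft {a : UqSl4Plus K q} (ha : a ∈ N) :
      ∃ b ∈ N, ∃ c ∈ N, a * e K q 0 = e K q 0 * b + c := by
    refine exists_mul_eq_of_mem_adjoin ?_ ha
    rintro a (rfl | rfl | rfl | rfl)
    · exact ⟨_, N.smul_mem m2 q⁻¹, 0, zero_mem _, by
        rw [X2_mul_e_zero hq, add_zero, mul_smul_comm]⟩
    · exact ⟨_, N.smul_mem m3 q⁻¹, 0, zero_mem _, by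
        rw [X3_mul_e_zero hq, add_zero, mul_smul_comm]⟩
    · exact ⟨_, N.smul_mem m4 q, _, neg_mem (N.smul_mem m2 q), by
        rw [X4_mul_e_zero hq, mul_smul_comm, sub_eq_add_neg]⟩
    · exact ⟨_, N.smul_mem m5 q, _, neg_mem (N.smul_mem m3 q), by
        rw [X5_mul_e_zero hq, mul_smul_comm, sub_eq_add_neg]⟩
  have hright {a : UqSl4Plus K q} (ha : a ∈ N) :
      ∃ b ∈ N, ∃ c ∈ N, e K q 2 * a = b * e K q 2 + c := by
    refine exists_eq_mul_of_mem_adjoin ?_ ha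
    rintro a (rfl | rfl | rfl | rfl)
    · exact ⟨_, N.smul_mem m2 q, _, neg_mem (N.smul_mem m3 q), by
        rw [e_two_mul_X2 hq, smul_mul_assoc, sub_eq_add_neg]⟩
    · exact ⟨_, N.smul_mem m3 q⁻¹, 0, zero_mem _, by
        rw [e_two_mul_X3 hq, add_zero, smul_mul_assoc]⟩
    · exact ⟨_, N.smul_mem m4 q, _, neg_mem (N.smul_mem m5 q), by
        rw [e_two_mul_X4 hq, smul_mul_assoc, sub_eq_add_neg]⟩
    · exact ⟨_, N.smul_mem m5 q⁻¹, 0, zero_mem _, by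
        rw [e_two_mul_X5 hq, add_zero, smul_mul_assoc]⟩
  set P := Submodule.span K (Set.range (pbw K q)) with hP
  have hmem {a f : ℕ} {n : UqSl4Plus K q} (hn : n ∈ N) : e K q 0 ^ a * n * e K q 2 ^ f ∈ P := by
    have h := adjoin_le_midSpan hq hq2 hn
    clear hn
    induction h using Submodule.span_induction with
    | mem n h =>
      obtain ⟨⟨b, c, d, i⟩, rfl⟩ := h
      exact Submodule.subset_span ⟨(a, b, c, d, i, f), rfl⟩
    | zero => simp
    | add x y _ _ hx hy => rw [mul_add, add_mul]; exact add_mem hx hy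
    | smul r x _ hx => rw [mul_smul_comm, smul_mul_assoc]; exact P.smul_mem r hx
  have hmid (b : ℤ) (c d i : ℕ) : midMonomial K q b c d i ∈ N := by
    have mD : Delta2 K q ∈ N := sub_mem (mul_mem m2 m5) (N.smul_mem (mul_mem m3 m4) q)
    refine mul_mem (mul_mem (mul_mem ?_ (pow_mem m3 c)) (pow_mem m4 d)) (pow_mem mD i)
    rcases b with n | n
    · exact pow_mem m2 n
    · exact pow_mem m5 (n + 1)
  -- `e_3 ^ f` is moved to the right of `x`, one factor at a time
  have hpow (a f : ℕ) : ∀ (g : ℕ) {n x : UqSl4Plus K q}, n ∈ N → x ∈ N →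
      e K q 0 ^ a * n * e K q 2 ^ f * x * e K q 2 ^ g ∈ P := by
    induction f with
    | zero =>
      intro g n x hn hx
      rw [pow_zero, mul_one, mul_assoc _ n]
      exact hmem (mul_mem hn hx)
    | succ f ih =>
      intro g n x hn hx
      obtain ⟨b, hb, c, hc, e1⟩ := hright hx
      have : e K q 0 ^ a * n * e K q 2 ^ (f + 1) * x * e K q 2 ^ g
          = e K q 0 ^ a * n * e K q 2 ^ f * b * e K q 2 ^ (g + 1)
            + e K q 0 ^ a * n * e K q 2 ^ f * c * e K q 2 ^ g := by
        rw [pow_succ (e K q 2) f, ← mul_assoc, mul_assoc _ (e K q 2) x, e1, pow_succ' (e K q 2) g]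
        simp only [mul_assoc, mul_add, add_mul]
      rw [this]
      exact add_mem (ih _ hn hb) (ih _ hn hc)
  refine mem_of_mul_e_mem ?_ ?_ x
  · have h := hmem (a := 0) (f := 0) (one_mem N)
    simpa using h
  · intro p hp j
    induction hp using Submodule.span_induction with
    | mem p hp =>
      obtain ⟨⟨a, b, c, d, i, f⟩, rfl⟩ := hp
      simp only [pbw]
      have hn := hmid b c d i
      fin_cases j
      · obtain ⟨u, hu, v, hv, e1⟩ := hleft hn
        have hc : Commute (e K q 2) (e K q 0) := e_zero_mul_e_two.symm
        have : e K q 0 ^ a * midMonomial K q b c d i * e K q 2 ^ f * e K q 0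
            = e K q 0 ^ (a + 1) * u * e K q 2 ^ f + e K q 0 ^ a * v * e K q 2 ^ f := by
          rw [mul_assoc, (hc.pow_left f).eq, ← mul_assoc, mul_assoc _ _ (e K q 0), e1, pow_succ]
          simp only [mul_assoc, mul_add, add_mul]
        exact this ▸ add_mem (hmem hu) (hmem hv)
      · have h := hpow a f 0 hn m4
        rwa [pow_zero, mul_one] at h
      · have h := hmem (a := a) (f := f + 1) hn
        rwa [pow_succ, ← mul_assoc] at h
    | zero => simp
    | add a b _ _ ha hb => rw [add_mul]; exact add_mem ha hb
    | smul r a _ ha => rw [smul_mul_assoc]; exact Submodule.smul_mem _ _ ha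

end PBW

end UqSl4Plus

/-! ### The skew torus and the homomorphism to it -/

section Model

/-- The Laurent polynomial ring `K[k^±1, w^±1, w'^±1]`, as the group algebra of `ℤ³` whose
coordinates are the exponents of `k`, `w` and `w'`. The parameter `q` only serves to define the
action of `ℤ²` on this ring. -/
def LaurentRing (K : Type*) [Field K] (_q : Kˣ) : Type _ := AddMonoidAlgebra K (ℤ × ℤ × ℤ)

namespace LaurentRing

variable {K : Type*} [Field K] {q : Kˣ}

noncomputable instance : CommRing (LaurentRing K q) :=
  inferInstanceAs (CommRing (AddMonoidAlgebra K (ℤ × ℤ × ℤ)))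

noncomputable instance : Algebra K (LaurentRing K q) :=
  inferInstanceAs (Algebra K (AddMonoidAlgebra K (ℤ × ℤ × ℤ)))

instance : IsDomain (LaurentRing K q) :=
  inferInstanceAs (IsDomain (AddMonoidAlgebra K (ℤ × ℤ × ℤ)))

variable (q) in
/-- The Laurent monomial with exponent `v`. -/
noncomputable def mon (v : ℤ × ℤ × ℤ) : LaurentRing K q := AddMonoidAlgebra.single v (1 : K)

variable (q) in
/-- The coefficient of a Laurent polynomial at the exponent `v`. -/
noncomputable def coeffAt (v : ℤ × ℤ × ℤ) : LaurentRing K q →ₗ[K] K where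
  toFun f := AddMonoidAlgebra.coeff f v
  map_add' _ _ := rfl
  map_smul' _ _ := rfl

theorem coeffAt_mon (v v' : ℤ × ℤ × ℤ) :
    coeffAt q v (mon q v') = if v' = v then 1 else 0 := by
  classical
  exact Finsupp.single_apply

theorem mon_mul_mon (v v' : ℤ × ℤ × ℤ) : mon q v * mon q v' = mon q (v + v') :=
  (AddMonoidAlgebra.single_mul_single v v' (1 : K) 1).trans (by rw [one_mul]; rfl)

theorem mon_zero : mon q (0 : ℤ × ℤ × ℤ) = (1 : LaurentRing K q) := rfl

theorem algHom_ext {A : Type*} [Semiring A] [Algebra K A] {f g : LaurentRing K q →ₐ[K] A}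
    (h : ∀ v, f (mon q v) = g (mon q v)) : f = g :=
  AddMonoidAlgebra.algHom_ext h (Subsingleton.elim _ _)

/-- The exponent of `q` by which `t ∈ ℤ²` scales the Laurent monomial with exponent `v`. The first
generator of `ℤ²` scales `k`, `w`, `w'` by `q`, `q ^ 2`, `1`; the second one by `q⁻¹`, `1`,
`(q ^ 2)⁻¹`. -/
def weight (t : ℤ × ℤ) (v : ℤ × ℤ × ℤ) : ℤ :=
  t.1 * (v.1 + 2 * v.2.1) - t.2 * (v.1 + 2 * v.2.2)

theorem weight_zero (t : ℤ × ℤ) : weight t 0 = 0 := by simp [weight]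

variable (K q) in
/-- The automorphism of the Laurent polynomial ring by which `t ∈ ℤ²` acts. -/
noncomputable def act (t : ℤ × ℤ) : LaurentRing K q →ₐ[K] LaurentRing K q :=
  AddMonoidAlgebra.lift K (LaurentRing K q) (ℤ × ℤ × ℤ)
    { toFun := fun v => ((q ^ weight t v.toAdd : Kˣ) : K) • mon q v.toAdd
      map_one' := by simp [weight, mon_zero]
      map_mul' := fun v v' => by
        rw [smul_mul_smul_comm, mon_mul_mon, ← Units.val_mul, ← zpow_add, toAdd_mul]
        congr 3
        simp only [weight, Prod.fst_add, Prod.snd_add]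
        ring }

theorem act_mon (t : ℤ × ℤ) (v : ℤ × ℤ × ℤ) :
    act K q t (mon q v) = ((q ^ weight t v : Kˣ) : K) • mon q v :=
  (AddMonoidAlgebra.lift_single _ v (1 : K)).trans (one_smul _ _)

noncomputable instance : MulSemiringAction (Multiplicative (ℤ × ℤ)) (LaurentRing K q) where
  smul t f := act K q t.toAdd f
  one_smul f := by
    have h : act K q 0 = AlgHom.id K _ := algHom_ext fun v => by simp [act_mon, weight]
    exact DFunLike.congr_fun h f
  mul_smul t t' f := by
    have h : act K q (t.toAdd + t'.toAdd) = (act K q t.toAdd).comp (act K q t'.toAdd) :=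
      algHom_ext fun v => by
        rw [AlgHom.comp_apply, act_mon, act_mon, map_smul, act_mon, smul_smul,
          ← Units.val_mul, ← zpow_add]
        congr 3
        simp only [weight, Prod.fst_add, Prod.snd_add]
        ring
    exact DFunLike.congr_fun h f
  smul_zero t := map_zero _
  smul_add t := map_add _
  smul_one t := map_one _
  smul_mul t := map_mul _

theorem smul_def (t : Multiplicative (ℤ × ℤ)) (f : LaurentRing K q) :
    t • f = act K q t.toAdd f := rfl

instance : SMulCommClass (Multiplicative (ℤ × ℤ)) K (LaurentRing K q) where
  smul_comm t c f := map_smul (act K q t.toAdd) c f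

end LaurentRing

open LaurentRing

/-- The skew group ring of `ℤ²` over `K[k^±1, w^±1, w'^±1][X]`, where `ℤ²` fixes `X`. It is a
quantum torus, except that the central variable `X` is not inverted. -/
abbrev SkewTorus (K : Type*) [Field K] (q : Kˣ) : Type _ :=
  SkewMonoidAlgebra (Polynomial (LaurentRing K q)) (Multiplicative (ℤ × ℤ))

namespace SkewTorus

variable {K : Type*} [Field K] {q : Kˣ}

/-- The additive structure is taken from the ring structure, so that it agrees syntactically with
the one underlying the algebra structure. -/
noncomputable instance : AddCommMonoid (SkewTorus K q) :=
  NonUnitalNonAssocSemiring.toAddCommMonoid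

noncomputable instance : AddCommGroup (SkewTorus K q) := Ring.toAddCommGroup

noncomputable instance : Module K (SkewTorus K q) := Algebra.toModule

variable (q) in
/-- The monomial of the skew torus with exponent `n` in `X`, `v` in `k, w, w'` and `t` in the group
`ℤ²`. -/
noncomputable def tmon (n : ℕ) (v : ℤ × ℤ × ℤ) (t : ℤ × ℤ) : SkewTorus K q :=
  SkewMonoidAlgebra.single (Multiplicative.ofAdd t) (Polynomial.monomial n (mon q v))

theorem tmon_mul_tmon (n n' : ℕ) (v v' : ℤ × ℤ × ℤ) (t t' : ℤ × ℤ) :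
    tmon q n v t * tmon q n' v' t'
      = ((q ^ weight t v' : Kˣ) : K) • tmon q (n + n') (v + v') (t + t') := by
  rw [tmon, tmon, SkewMonoidAlgebra.single_mul_single, Polynomial.smul_monomial,
    Polynomial.monomial_mul_monomial, LaurentRing.smul_def, toAdd_ofAdd, act_mon,
    mul_smul_comm, mon_mul_mon, ← Polynomial.smul_monomial, ← SkewMonoidAlgebra.smul_single]
  rfl

theorem tmon_zero : tmon q 0 0 0 = (1 : SkewTorus K q) := rfl

end SkewTorus

end Model

section Representation

set_option linter.unusedSimpArgs false
set_option linter.unnecessarySeqFocus false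

open LaurentRing SkewTorus

variable {K : Type*} [Field K] {q : Kˣ}

variable (q) in
/-- The images of the generators of `U` in the skew torus. Writing `g` and `g'` for the generators
of `ℤ²`, they are `k⁻¹ (g + g')`, `k` and `((X + w) g⁻¹ + (q ^ 2 X + w') g'⁻¹) k⁻¹`. -/
noncomputable def torusGen : Fin 3 → SkewTorus K q
  | 0 => tmon q 0 (-1, 0, 0) (1, 0) + tmon q 0 (-1, 0, 0) (0, 1)
  | 1 => tmon q 0 (1, 0, 0) (0, 0)
  | 2 => (q : K) • (tmon q 1 (-1, 0, 0) (-1, 0) + tmon q 0 (-1, 1, 0) (-1, 0))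
      + (q : K)⁻¹ • ((q : K) ^ 2 • tmon q 1 (-1, 0, 0) (0, -1) + tmon q 0 (-1, 0, 1) (0, -1))

theorem torusGen_comm : torusGen q 0 * torusGen q 2 = torusGen q 2 * torusGen q 0 := by
  have hq : (q : K) ≠ 0 := q.ne_zero
  simp only [torusGen, mul_add, add_mul, mul_smul_comm, smul_mul_assoc, tmon_mul_tmon, weight,
      Prod.mk_add_mk, Prod.fst_zero, Prod.snd_zero, Prod.mk_zero_zero, Int.reduceAdd, Int.reduceMul,
      Int.reduceNeg, Int.reduceSub, Nat.reduceAdd, mul_zero, zero_mul, add_zero, zero_add, sub_zero,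
      zero_sub, mul_one, one_mul, mul_neg, neg_mul, neg_neg, Units.val_zpow_eq_zpow_val,
      zpow_zero, neg_zero, Units.val_one]
  match_scalars <;> field_simp <;> ring

theorem torusGen_serre (i j : Fin 3) (hij : i.val + 1 = j.val ∨ j.val + 1 = i.val) :
    torusGen q i ^ 2 * torusGen q j
        - ((q : K) + (q : K)⁻¹) • (torusGen q i * torusGen q j * torusGen q i)
      + torusGen q j * torusGen q i ^ 2 = 0 := by
  have hq : (q : K) ≠ 0 := q.ne_zero
  fin_cases i <;> fin_cases j <;> simp at hij
  all_goals
    simp only [torusGen, pow_two, mul_add, add_mul, mul_smul_comm, smul_mul_assoc, tmon_mul_tmon,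
      weight,
      Prod.mk_add_mk, Prod.fst_zero, Prod.snd_zero, Prod.mk_zero_zero, Int.reduceAdd, Int.reduceMul,
      Int.reduceNeg, Int.reduceSub, Nat.reduceAdd, mul_zero, zero_mul, add_zero, zero_add, sub_zero,
      zero_sub, mul_one, one_mul, mul_neg, neg_mul, neg_neg, Units.val_zpow_eq_zpow_val,
      zpow_zero, neg_zero, Units.val_one]
    match_scalars <;> field_simp <;> ring

variable (q) in
/-- The embedding of `U` into the skew torus. -/
noncomputable def toTorus : UqSl4Plus K (q : K) →ₐ[K] SkewTorus K q :=
  RingQuot.liftAlgHom K ⟨FreeAlgebra.lift K (torusGen q), by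
    rintro _ _ (_ | ⟨i, j, hij⟩)
    · simp only [map_sub, map_mul, FreeAlgebra.lift_ι_apply, map_zero, torusGen_comm, sub_self]
    · simpa only [map_sub, map_add, map_smul, map_mul, map_pow, FreeAlgebra.lift_ι_apply, map_zero]
        using torusGen_serre i j hij⟩

open UqSl4Plus

theorem toTorus_e (i : Fin 3) : toTorus q (e K q i) = torusGen q i := by
  rw [toTorus, e, RingQuot.liftAlgHom_mkAlgHom_apply, FreeAlgebra.lift_ι_apply]

theorem toTorus_X4 : toTorus q (X4 K q) = tmon q 0 (1, 0, 0) 0 := toTorus_e 1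

theorem toTorus_X2 :
    toTorus q (X2 K q) = ((q : K) - (q : K)⁻¹) • tmon q 0 0 (1, 0) := by
  have hq : (q : K) ≠ 0 := q.ne_zero
  simp only [X2, map_sub, map_mul, map_smul, toTorus_e, torusGen, mul_add, add_mul,
      mul_smul_comm, smul_mul_assoc, tmon_mul_tmon, weight,
      Prod.mk_add_mk, Prod.fst_zero, Prod.snd_zero, Prod.mk_zero_zero, Int.reduceAdd, Int.reduceMul,
      Int.reduceNeg, Int.reduceSub, Nat.reduceAdd, mul_zero, zero_mul, add_zero, zero_add, sub_zero,
      zero_sub, mul_one, one_mul, mul_neg, neg_mul, neg_neg, Units.val_zpow_eq_zpow_val, zpow_zero,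
      neg_zero, Units.val_one]
  match_scalars <;> field_simp <;> ring

theorem toTorus_X5 :
    toTorus q (X5 K q) = ((q : K) - (q : K)⁻¹) •
      (tmon q 1 0 (-1, 0) + tmon q 0 (0, 1, 0) (-1, 0)) := by
  have hq : (q : K) ≠ 0 := q.ne_zero
  simp only [X5, map_sub, map_mul, map_smul, toTorus_e, torusGen, mul_add, add_mul,
      mul_smul_comm, smul_mul_assoc, tmon_mul_tmon, weight,
      Prod.mk_add_mk, Prod.fst_zero, Prod.snd_zero, Prod.mk_zero_zero, Int.reduceAdd, Int.reduceMul,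
      Int.reduceNeg, Int.reduceSub, Nat.reduceAdd, mul_zero, zero_mul, add_zero, zero_add, sub_zero,
      zero_sub, mul_one, one_mul, mul_neg, neg_mul, neg_neg, Units.val_zpow_eq_zpow_val, zpow_zero,
      neg_zero, Units.val_one]
  match_scalars <;> field_simp <;> ring

theorem toTorus_X3 :
    toTorus q (X3 K q) = (((q : K) - (q : K)⁻¹) ^ 2 * q) • tmon q 0 (-1, 1, 0) 0 := by
  have hq : (q : K) ≠ 0 := q.ne_zero
  simp only [X3, toTorus_X5, map_sub, map_mul,
      map_smul, toTorus_e, torusGen, mul_add, add_mul,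
      mul_smul_comm, smul_mul_assoc, tmon_mul_tmon, weight,
      Prod.mk_add_mk, Prod.fst_zero, Prod.snd_zero, Prod.mk_zero_zero, Int.reduceAdd, Int.reduceMul,
      Int.reduceNeg, Int.reduceSub, Nat.reduceAdd, mul_zero, zero_mul, add_zero, zero_add, sub_zero,
      zero_sub, mul_one, one_mul, mul_neg, neg_mul, neg_neg, Units.val_zpow_eq_zpow_val, zpow_zero,
      neg_zero, Units.val_one]
  match_scalars <;> field_simp <;> ring

theorem toTorus_Delta2 :
    toTorus q (Delta2 K q) = ((q : K) - (q : K)⁻¹) ^ 2 • tmon q 1 0 0 := by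
  have hq : (q : K) ≠ 0 := q.ne_zero
  simp only [Delta2, toTorus_X2, toTorus_X3, toTorus_X4, toTorus_X5, map_sub, map_mul,
      map_smul, toTorus_e, torusGen, mul_add, add_mul,
      mul_smul_comm, smul_mul_assoc, tmon_mul_tmon, weight,
      Prod.mk_add_mk, Prod.fst_zero, Prod.snd_zero, Prod.mk_zero_zero, Int.reduceAdd, Int.reduceMul,
      Int.reduceNeg, Int.reduceSub, Nat.reduceAdd, mul_zero, zero_mul, add_zero, zero_add, sub_zero,
      zero_sub, mul_one, one_mul, mul_neg, neg_mul, neg_neg, Units.val_zpow_eq_zpow_val, zpow_zero,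
      neg_zero, Units.val_one]
  match_scalars <;> field_simp <;> ring

end Representation

/-! ### Leading monomials and injectivity -/

/-- Extraction of coefficients from a family that is triangular for a system of coordinate
functionals: among the indices of `I` with a nonzero coefficient, one of maximal degree is detected
by its functional. -/
theorem Finsupp.apply_eq_zero_of_triangular {ι K M : Type*} [Field K] [AddCommGroup M] [Module K M]
    (f : ι → M) (l : ι → M →ₗ[K] K) (deg : ι → ℤ) (hdiag : ∀ i, l i (f i) ≠ 0)
    (htri : ∀ i j, j ≠ i → deg j ≤ deg i → l i (f j) = 0) (I : Set ι)
    (hI : ∀ i ∈ I, ∀ j ∉ I, l i (f j) = 0) (c : ι →₀ K)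
    (hc : ∀ i ∈ I, l i (Finsupp.linearCombination K f c) = 0) : ∀ i ∈ I, c i = 0 := by
  classical
  by_contra! h
  obtain ⟨i₀, hi₀, hci₀⟩ := h
  obtain ⟨i, hi, hmax⟩ := (c.support.filter (· ∈ I)).exists_max_image deg ⟨i₀, by simp [hi₀, hci₀]⟩
  obtain ⟨hi, hiI⟩ := Finset.mem_filter.1 hi
  have h := hc i hiI
  rw [Finsupp.linearCombination_apply, Finsupp.sum, map_sum, Finset.sum_eq_single i] at h
  · rw [map_smul, smul_eq_mul] at h
    exact (mul_ne_zero (Finsupp.mem_support_iff.1 hi) (hdiag i)) h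
  · intro j hj hji
    rw [map_smul]
    by_cases hjI : j ∈ I
    · rw [htri i j hji (hmax j (Finset.mem_filter.2 ⟨hj, hjI⟩)), smul_zero]
    · rw [hI i hiI j hjI, smul_zero]
  · exact fun h => absurd hi h

namespace SkewTorus

open LaurentRing

section LeadingTerms

variable {K : Type*} [Field K] {q : Kˣ}

/-- The exponents of the monomials `tmon` of the skew torus. -/
abbrev Exponent : Type := ℕ × (ℤ × ℤ × ℤ) × (ℤ × ℤ)

variable (q) in
/-- The monomial with a given exponent. -/
noncomputable def emon (m : Exponent) : SkewTorus K q := tmon q m.1 m.2.1 m.2.2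

theorem emon_mul_emon (m m' : Exponent) :
    emon q m * emon q m' = ((q ^ weight m.2.2 m'.2.1 : Kˣ) : K) • emon q (m + m') :=
  tmon_mul_tmon ..

/-- The degree used to single out leading monomials: `w'` has degree `2`, the second generator of
`ℤ²` has degree `1`, `X` has degree `-1`, and all other variables have degree `0`. -/
def deg : Exponent →+ ℤ where
  toFun m := m.2.2.2 + 2 * m.2.1.2.2 - m.1
  map_zero' := by simp
  map_add' m m' := by simp; ring

variable (q) in
/-- The span of the monomials of degree less than `n`. -/
noncomputable def lowerSpan (n : ℤ) : Submodule K (SkewTorus K q) :=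
  Submodule.span K {x | ∃ m, deg m < n ∧ emon q m = x}

theorem emon_mem_lowerSpan {m : Exponent} {n : ℤ} (h : deg m < n) : emon q m ∈ lowerSpan q n :=
  Submodule.subset_span ⟨m, h, rfl⟩

theorem mul_mem_lowerSpan {n n' p : ℤ} (h : n + n' ≤ p + 1) {x y : SkewTorus K q}
    (hx : x ∈ lowerSpan q n) (hy : y ∈ lowerSpan q n') : x * y ∈ lowerSpan q p := by
  have hxy := Submodule.mul_mem_mul hx hy
  rw [lowerSpan, lowerSpan, Submodule.span_mul_span] at hxy
  refine Submodule.span_le.2 ?_ hxy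
  rintro _ ⟨_, ⟨m, hm, rfl⟩, _, ⟨m', hm', rfl⟩, rfl⟩
  simp only [emon_mul_emon]
  refine Submodule.smul_mem _ _ (emon_mem_lowerSpan ?_)
  rw [map_add]
  lia

/-- `s` is a nonzero multiple of the monomial with exponent `m`, up to monomials of lower degree. -/
def HasLead (s : SkewTorus K q) (m : Exponent) : Prop :=
  ∃ c : K, c ≠ 0 ∧ s - c • emon q m ∈ lowerSpan q (deg m)

theorem HasLead.mul {s s' : SkewTorus K q} {m m' : Exponent} (h : HasLead s m)
    (h' : HasLead s' m') : HasLead (s * s') (m + m') := by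
  obtain ⟨c, hc, hs⟩ := h
  obtain ⟨c', hc', hs'⟩ := h'
  refine ⟨c * c' * (q ^ weight m.2.2 m'.2.1 : Kˣ),
    mul_ne_zero (mul_ne_zero hc hc') (Units.ne_zero _), ?_⟩
  have e : s * s' - (c * c' * ((q ^ weight m.2.2 m'.2.1 : Kˣ) : K)) • emon q (m + m')
      = (s - c • emon q m) * (s' - c' • emon q m') + c • (emon q m * (s' - c' • emon q m'))
        + c' • ((s - c • emon q m) * emon q m') := by
    rw [mul_smul, ← emon_mul_emon]
    simp only [mul_sub, sub_mul, mul_smul_comm, smul_mul_assoc]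
    module
  have hm : emon q m ∈ lowerSpan q (deg m + 1) := emon_mem_lowerSpan (lt_add_one _)
  have hm' : emon q m' ∈ lowerSpan q (deg m' + 1) := emon_mem_lowerSpan (lt_add_one _)
  rw [e, map_add]
  refine add_mem (add_mem (mul_mem_lowerSpan ?_ hs hs')
    (Submodule.smul_mem _ _ (mul_mem_lowerSpan ?_ hm hs')))
    (Submodule.smul_mem _ _ (mul_mem_lowerSpan ?_ hs hm')) <;> lia

theorem hasLead_one : HasLead (1 : SkewTorus K q) 0 :=
  ⟨1, one_ne_zero, by
    have h : emon q 0 = (1 : SkewTorus K q) := tmon_zero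
    rw [h, one_smul, sub_self]; exact zero_mem _⟩

theorem HasLead.pow {s : SkewTorus K q} {m : Exponent} (h : HasLead s m) (n : ℕ) :
    HasLead (s ^ n) (n • m) := by
  induction n with
  | zero => simpa using hasLead_one
  | succ n ih => rw [pow_succ, succ_nsmul]; exact ih.mul h

theorem hasLead_smul_emon {c : K} (hc : c ≠ 0) (m : Exponent) : HasLead (c • emon q m) m :=
  ⟨c, hc, by rw [sub_self]; exact zero_mem _⟩

theorem hasLead_smul_tmon {c : K} (hc : c ≠ 0) (n : ℕ) (v : ℤ × ℤ × ℤ) (t : ℤ × ℤ) :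
    HasLead (c • tmon q n v t) (n, v, t) :=
  hasLead_smul_emon hc (n, v, t)

theorem HasLead.add {s x : SkewTorus K q} {m : Exponent} (h : HasLead s m)
    (hx : x ∈ lowerSpan q (deg m)) : HasLead (s + x) m := by
  obtain ⟨c, hc, hs⟩ := h
  exact ⟨c, hc, by rw [add_sub_right_comm]; exact add_mem hs hx⟩

variable (q) in
/-- The coefficient of an element of the skew torus at the monomial with exponent `m`. -/
noncomputable def coord (m : Exponent) : SkewTorus K q →ₗ[K] K where
  toFun s := coeffAt q m.2.1 ((s.coeff (Multiplicative.ofAdd m.2.2)).coeff m.1)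
  map_add' s s' := by simp
  map_smul' c s := by simp

theorem coord_emon (m m' : Exponent) : coord q m (emon q m') = if m' = m then 1 else 0 := by
  classical
  obtain ⟨n, v, t⟩ := m
  obtain ⟨n', v', t'⟩ := m'
  simp only [coord, emon, tmon, LinearMap.coe_mk, AddHom.coe_mk,
    SkewMonoidAlgebra.coeff_single_apply, Prod.mk.injEq, EmbeddingLike.apply_eq_iff_eq]
  by_cases ht : t' = t
  · by_cases hn : n' = n
    · simp [ht, hn, coeffAt_mon]
    · simp [ht, hn, Polynomial.coeff_monomial]
  · simp [ht]

theorem coord_eq_zero_of_mem_lowerSpan {m : Exponent} {n : ℤ} (h : n ≤ deg m) {s : SkewTorus K q}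
    (hs : s ∈ lowerSpan q n) : coord q m s = 0 := by
  refine (Submodule.span_le (p := LinearMap.ker (coord q m))).2 ?_ hs
  rintro _ ⟨m', hm', rfl⟩
  rw [SetLike.mem_coe, LinearMap.mem_ker, coord_emon, if_neg]
  rintro rfl
  lia

theorem HasLead.coord_ne_zero {s : SkewTorus K q} {m : Exponent} (h : HasLead s m) :
    coord q m s ≠ 0 := by
  obtain ⟨c, hc, hs⟩ := h
  have := coord_eq_zero_of_mem_lowerSpan le_rfl hs
  rw [map_sub, map_smul, coord_emon, if_pos rfl, sub_eq_zero] at this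
  rw [this]
  simpa using hc

theorem HasLead.coord_eq_zero {s : SkewTorus K q} {m m' : Exponent} (h : HasLead s m)
    (hne : m ≠ m') (hdeg : deg m ≤ deg m') : coord q m' s = 0 := by
  obtain ⟨c, hc, hs⟩ := h
  have := coord_eq_zero_of_mem_lowerSpan hdeg hs
  rw [map_sub, map_smul, coord_emon, if_neg hne, sub_eq_zero] at this
  rw [this, smul_zero]

end LeadingTerms

section Embedding

open UqSl4Plus

variable {K : Type*} [Field K] {q : Kˣ}

/-- The exponent of the leading monomial of the image of a PBW monomial. -/
def leadExponent (p : ℕ × ℤ × ℕ × ℕ × ℕ × ℕ) : Exponent :=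
  (p.2.2.2.2.1,
    (-(p.1 : ℤ) - p.2.2.1 + p.2.2.2.1 - p.2.2.2.2.2, (-p.2.1).toNat + p.2.2.1, p.2.2.2.2.2),
    (p.2.1, (p.1 : ℤ) - p.2.2.2.2.2))

theorem leadExponent_injective : Function.Injective leadExponent := by
  rintro ⟨a, b, c, d, i, f⟩ ⟨a', b', c', d', i', f'⟩ h
  simp only [leadExponent, Prod.mk.injEq] at h ⊢
  lia

theorem sub_inv_ne_zero (hq2 : (q : K) ^ 2 ≠ 1) : (q : K) - (q : K)⁻¹ ≠ 0 := by
  intro h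
  apply hq2
  have hq : (q : K) ≠ 0 := q.ne_zero
  rw [sub_eq_zero] at h
  rw [pow_two]
  nth_rewrite 2 [h]
  exact mul_inv_cancel₀ hq

theorem hasLead_toTorus_e_zero :
    HasLead (toTorus q (e K q 0)) (0, (-1, 0, 0), (0, 1)) := by
  have h := (hasLead_smul_emon (q := q) one_ne_zero (0, (-1, 0, 0), (0, 1))).add
    (emon_mem_lowerSpan (m := (0, (-1, 0, 0), (1, 0))) (by simp [deg]))
  rw [one_smul, add_comm] at h
  rw [toTorus_e]
  exact h

theorem hasLead_toTorus_e_two :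
    HasLead (toTorus q (e K q 2)) (0, (-1, 0, 1), (0, -1)) := by
  have h := (hasLead_smul_emon (q := q) (inv_ne_zero q.ne_zero) (0, (-1, 0, 1), (0, -1))).add
    (add_mem (add_mem
      (Submodule.smul_mem _ (q : K) (emon_mem_lowerSpan (m := (1, (-1, 0, 0), (-1, 0)))
        (by simp [deg])))
      (Submodule.smul_mem _ (q : K) (emon_mem_lowerSpan (m := (0, (-1, 1, 0), (-1, 0)))
        (by simp [deg]))))
      (Submodule.smul_mem _ ((q : K)⁻¹ * (q : K) ^ 2)
        (emon_mem_lowerSpan (m := (1, (-1, 0, 0), (0, -1))) (by simp [deg]))))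
  rw [toTorus_e]
  convert h using 1
  simp only [torusGen, emon]
  module

theorem hasLead_toTorus_X2X5Pow (hq2 : (q : K) ^ 2 ≠ 1) (b : ℤ) :
    HasLead (toTorus q (X2X5Pow K q b)) (0, (0, (-b).toNat, 0), (b, 0)) := by
  rcases b with n | n
  · have h := (hasLead_smul_emon (q := q) (sub_inv_ne_zero hq2) (0, 0, (1, 0))).pow n
    have e1 : toTorus q (X2X5Pow K q (.ofNat n))
        = (((q : K) - (q : K)⁻¹) • emon q (0, 0, (1, 0))) ^ n := by
      rw [X2X5Pow, map_pow, toTorus_X2]; rfl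
    rw [e1]
    convert h using 1
    simp
  · have h := ((hasLead_smul_emon (q := q) (sub_inv_ne_zero hq2) (0, (0, 1, 0), (-1, 0))).add
      (Submodule.smul_mem _ ((q : K) - (q : K)⁻¹) (emon_mem_lowerSpan (m := (1, 0, (-1, 0)))
        (by simp [deg])))).pow (n + 1)
    rw [← smul_add, add_comm] at h
    have e1 : toTorus q (X2X5Pow K q (.negSucc n)) = (((q : K) - (q : K)⁻¹) •
        (emon q (1, 0, (-1, 0)) + emon q (0, (0, 1, 0), (-1, 0)))) ^ (n + 1) := by
      rw [X2X5Pow, map_pow, toTorus_X5]; rfl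
    rw [e1]
    convert h using 1
    simp [Int.negSucc_eq]

theorem hasLead_toTorus_pbw (hq2 : (q : K) ^ 2 ≠ 1) (p : ℕ × ℤ × ℕ × ℕ × ℕ × ℕ) :
    HasLead (toTorus q (pbw K q p)) (leadExponent p) := by
  obtain ⟨a, b, c, d, i, f⟩ := p
  have hν := sub_inv_ne_zero hq2
  have h3 : HasLead (toTorus q (X3 K q)) (0, (-1, 1, 0), 0) := by
    rw [toTorus_X3]
    exact hasLead_smul_tmon (mul_ne_zero (pow_ne_zero 2 hν) q.ne_zero) _ _ _
  have h4 : HasLead (toTorus q (X4 K q)) (0, (1, 0, 0), 0) := by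
    have h := hasLead_smul_tmon (q := q) one_ne_zero 0 (1, 0, 0) 0
    rw [one_smul] at h
    rw [toTorus_X4]
    exact h
  have hD : HasLead (toTorus q (Delta2 K q)) (1, 0, 0) := by
    rw [toTorus_Delta2]
    exact hasLead_smul_tmon (pow_ne_zero 2 hν) _ _ _
  have h := ((hasLead_toTorus_e_zero.pow a).mul ((((hasLead_toTorus_X2X5Pow hq2 b).mul
    (h3.pow c)).mul (h4.pow d)).mul (hD.pow i))).mul (hasLead_toTorus_e_two.pow f)
  simp only [pbw, midMonomial, map_mul, map_pow]
  convert h using 1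
  simp only [leadExponent, Prod.ext_iff]
  simp
  lia

theorem coord_leadExponent_pbw_eq_zero (hq2 : (q : K) ^ 2 ≠ 1) (p p' : ℕ × ℤ × ℕ × ℕ × ℕ × ℕ)
    (hne : p' ≠ p) (hdeg : deg (leadExponent p') ≤ deg (leadExponent p)) :
    coord q (leadExponent p) (toTorus q (pbw K q p')) = 0 :=
  (hasLead_toTorus_pbw hq2 p').coord_eq_zero (leadExponent_injective.ne hne) hdeg

theorem toTorus_injective (hq2 : (q : K) ^ 2 ≠ 1) (hq4 : (q : K) ^ 2 + 1 ≠ 0) :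
    Function.Injective (toTorus q) := by
  rw [injective_iff_map_eq_zero]
  intro x hx
  obtain ⟨c, rfl⟩ := (Finsupp.mem_span_range_iff_exists_finsupp).1 (mem_span_pbw q.ne_zero hq4 x)
  have hc : c = 0 := Finsupp.ext fun p =>
    Finsupp.apply_eq_zero_of_triangular (fun p => toTorus q (pbw K q p))
      (fun p => coord q (leadExponent p)) (fun p => deg (leadExponent p))
      (fun p => (hasLead_toTorus_pbw hq2 p).coord_ne_zero)
      (coord_leadExponent_pbw_eq_zero hq2) Set.univ (fun _ _ j hj => absurd (Set.mem_univ j) hj) c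
      (fun p _ => by
        rw [map_finsuppSum] at hx
        simp only [map_smul] at hx
        rw [Finsupp.linearCombination_apply, hx, map_zero]) p (Set.mem_univ p)
  rw [hc, Finsupp.sum_zero_index]

theorem commute_tmon_X (s : SkewTorus K q) : Commute (tmon q 1 0 0) s := by
  ext t n
  rw [tmon, SkewMonoidAlgebra.coeff_single_mul, SkewMonoidAlgebra.coeff_mul_single, ofAdd_zero,
    mon_zero, inv_one, one_mul, mul_one, one_smul]
  have h : (Polynomial.monomial 1 (1 : LaurentRing K q)) = Polynomial.X := rfl
  rw [h, Polynomial.smul_X, mul_comm]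

theorem Delta2_mem_center (hq2 : (q : K) ^ 2 ≠ 1) (hq4 : (q : K) ^ 2 + 1 ≠ 0) :
    Delta2 K (q : K) ∈ Subalgebra.center K (UqSl4Plus K (q : K)) := by
  rw [Subalgebra.mem_center_iff]
  intro b
  apply toTorus_injective hq2 hq4
  rw [map_mul, map_mul, toTorus_Delta2, mul_smul_comm, smul_mul_assoc, (commute_tmon_X _).eq]

theorem Delta2_mul_cancel (hq2 : (q : K) ^ 2 ≠ 1) (hq4 : (q : K) ^ 2 + 1 ≠ 0)
    {x y : UqSl4Plus K (q : K)} (h : Delta2 K (q : K) * x = Delta2 K q * y) : x = y := by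
  apply toTorus_injective hq2 hq4
  have h' := congrArg (toTorus q) h
  rw [map_mul, map_mul, toTorus_Delta2, smul_mul_assoc, smul_mul_assoc] at h'
  have h2 := smul_right_injective _ (pow_ne_zero 2 (sub_inv_ne_zero hq2)) h'
  ext1 t
  have h3 := congrArg (fun s => SkewMonoidAlgebra.coeff s t) h2
  simp only [tmon, SkewMonoidAlgebra.coeff_single_mul, ofAdd_zero, inv_one, one_mul, one_smul,
    mon_zero] at h3
  exact mul_left_cancel₀ Polynomial.X_ne_zero h3

theorem Delta2_ne_zero (hq2 : (q : K) ^ 2 ≠ 1) : Delta2 K (q : K) ≠ 0 := by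
  intro h
  have h' := toTorus_Delta2 (q := q)
  rw [h, map_zero] at h'
  have h2 := congrArg (coord q (1, 0, 0)) h'
  rw [map_zero, map_smul] at h2
  have h3 := coord_emon (q := q) (1, 0, 0) (1, 0, 0)
  rw [if_pos rfl] at h3
  erw [h3] at h2
  rw [smul_eq_mul, mul_one] at h2
  exact pow_ne_zero 2 (sub_inv_ne_zero hq2) h2.symm

theorem pbw_succ (hq2 : (q : K) ^ 2 ≠ 1) (hq4 : (q : K) ^ 2 + 1 ≠ 0) (a : ℕ) (b : ℤ)
    (c d i f : ℕ) : pbw K (q : K) (a, b, c, d, i + 1, f)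
      = Delta2 K q * pbw K q (a, b, c, d, i, f) := by
  have h (x : UqSl4Plus K (q : K)) : Commute (Delta2 K (q : K)) x :=
    ((Subalgebra.mem_center_iff.1 (Delta2_mem_center hq2 hq4)) x).symm
  simp only [pbw, midMonomial]
  rw [pow_succ, ← mul_assoc _ _ (Delta2 K (q : K)), ← (h _).eq, ← mul_assoc, ← (h _).eq]
  simp only [mul_assoc]

/-- An element of `U` whose image in the skew torus is divisible by `X` is divisible by `Δ_2`. -/
theorem exists_eq_Delta2_mul (hq2 : (q : K) ^ 2 ≠ 1) (hq4 : (q : K) ^ 2 + 1 ≠ 0)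
    {x : UqSl4Plus K (q : K)}
    (hx : ∀ t, Polynomial.X ∣ SkewMonoidAlgebra.coeff (toTorus q x) t) :
    ∃ y, x = Delta2 K (q : K) * y := by
  have hcoord {s : SkewTorus K q} (hs : ∀ t, Polynomial.X ∣ SkewMonoidAlgebra.coeff s t)
      (v : ℤ × ℤ × ℤ) (t : ℤ × ℤ) : coord q (0, v, t) s = 0 := by
    simp only [coord, LinearMap.coe_mk, AddHom.coe_mk]
    rw [Polynomial.X_dvd_iff.1 (hs _), map_zero]
  obtain ⟨c, rfl⟩ := (Finsupp.mem_span_range_iff_exists_finsupp).1 (mem_span_pbw q.ne_zero hq4 x)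
  have hc := Finsupp.apply_eq_zero_of_triangular (fun p => toTorus q (pbw K q p))
      (fun p => coord q (leadExponent p)) (fun p => deg (leadExponent p))
      (fun p => (hasLead_toTorus_pbw hq2 p).coord_ne_zero)
      (coord_leadExponent_pbw_eq_zero hq2) {p | p.2.2.2.2.1 = 0} (by
        rintro ⟨a, b, c, d, _, f⟩ rfl ⟨a', b', c', d', _ | i', f'⟩ hj
        · exact absurd rfl hj
        · refine hcoord (fun t => ?_) _ _
          rw [pbw_succ hq2 hq4, map_mul, toTorus_Delta2, smul_mul_assoc,
            SkewMonoidAlgebra.coeff_smul]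
          simp only [Finsupp.coe_smul, Pi.smul_apply, tmon, SkewMonoidAlgebra.coeff_single_mul,
            mon_zero]
          exact dvd_smul_of_dvd _ ⟨_, rfl⟩) c (by
        rintro ⟨a, b, c', d, _, f⟩ rfl
        refine hcoord (fun t => ?_) _ _
        have h := hx t
        rw [map_finsuppSum] at h
        simp only [map_smul] at h
        exact h)
  have hmem : (c.sum fun p r => r • pbw K (q : K) p)
      ∈ LinearMap.range (LinearMap.mulLeft K (Delta2 K (q : K))) := by
    refine Submodule.sum_mem _ ?_
    rintro ⟨a, b, c', d, _ | i, f⟩ _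
    · simp only [hc (a, b, c', d, 0, f) rfl, zero_smul]
      exact zero_mem _
    · refine Submodule.smul_mem _ _ ⟨pbw K (q : K) (a, b, c', d, i, f), ?_⟩
      rw [pbw_succ hq2 hq4]
      rfl
  obtain ⟨y, hy⟩ := hmem
  exact ⟨y, hy.symm⟩

end Embedding

end SkewTorus

/-! ### Derivations -/

namespace SkewTorus

open LaurentRing UqSl4Plus Multiplicative

section Coefficients

variable {K : Type*} [Field K] {q : Kˣ}

theorem coeff_tmon_mul (n : ℕ) (v : ℤ × ℤ × ℤ) (t : ℤ × ℤ) (s : SkewTorus K q)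
    (y : Multiplicative (ℤ × ℤ)) :
    (tmon q n v t * s).coeff y
      = Polynomial.monomial n (mon q v) * ofAdd t • s.coeff ((ofAdd t)⁻¹ * y) :=
  SkewMonoidAlgebra.coeff_single_mul ..

theorem coeff_mul_tmon (n : ℕ) (v : ℤ × ℤ × ℤ) (t : ℤ × ℤ) (s : SkewTorus K q)
    (y : Multiplicative (ℤ × ℤ)) :
    (s * tmon q n v t).coeff y = ((q ^ weight (y * (ofAdd t)⁻¹).toAdd v : Kˣ) : K) •
      (s.coeff (y * (ofAdd t)⁻¹) * Polynomial.monomial n (mon q v)) := by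
  rw [tmon, SkewMonoidAlgebra.coeff_mul_single, Polynomial.smul_monomial, LaurentRing.smul_def,
    act_mon, ← Polynomial.smul_monomial, mul_smul_comm]

theorem weight_eq_zero_of_commute (hq : ∀ n : ℕ, 0 < n → (q : K) ^ n ≠ 1) {v : ℤ × ℤ × ℤ}
    {s : SkewTorus K q} (h : Commute s (tmon q 0 v 0)) {t : ℤ × ℤ} (ht : s.coeff (ofAdd t) ≠ 0) :
    weight t v = 0 := by
  have h1 := congrArg (fun x => SkewMonoidAlgebra.coeff x (ofAdd t)) h.eq
  simp only [coeff_tmon_mul, coeff_mul_tmon, ofAdd_zero, inv_one, one_mul, mul_one, one_smul,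
    toAdd_ofAdd] at h1
  rw [mul_comm (Polynomial.monomial 0 _)] at h1
  have h2 : (((q ^ weight t v : Kˣ) : K) - 1) •
      (s.coeff (ofAdd t) * Polynomial.monomial 0 (mon q v)) = 0 := by
    rw [sub_smul, one_smul, h1, sub_self]
  rw [smul_eq_zero] at h2
  have hv : Polynomial.monomial 0 (mon q v) ≠ 0 := by
    rw [Ne, Polynomial.monomial_eq_zero_iff]
    intro h
    have h2 := coeffAt_mon (q := q) v v
    rw [h, map_zero, if_pos rfl] at h2
    exact zero_ne_one h2
  have h3 : q ^ weight t v = 1 :=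
    Units.ext (sub_eq_zero.1 (h2.resolve_right (mul_ne_zero ht hv)))
  by_contra hw
  refine hq (weight t v).natAbs (Int.natAbs_pos.2 hw) ?_
  rw [← Units.val_pow_eq_pow_val, ← zpow_natCast]
  rcases Int.natAbs_eq (weight t v) with e | e
  · rw [← e, h3, Units.val_one]
  · rw [← neg_neg (((weight t v).natAbs : ℕ) : ℤ), ← e, zpow_neg, h3, inv_one, Units.val_one]

variable (q) in
/-- The polynomial `X + w`; a scalar multiple of it is the image of `X_5 X_2`. -/
noncomputable def XAddW : Polynomial (LaurentRing K q) :=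
  Polynomial.X + Polynomial.C (mon q (0, 1, 0))

theorem monomial_add_monomial_eq (v : ℤ × ℤ × ℤ) :
    Polynomial.monomial 1 (mon q v) + Polynomial.monomial 0 (mon q (v + (0, 1, 0)))
      = Polynomial.C (mon q v) * XAddW q := by
  rw [XAddW, mul_add, ← Polynomial.C_mul, mon_mul_mon, Polynomial.C_mul_X_eq_monomial,
    Polynomial.monomial_zero_left]

/-- In the image of `U`, every coefficient at a group element whose first component is negative is
divisible by `X + w`: the first generator of `ℤ²` is inverted only through the image of `e_3`,
where its inverse comes with the factor `X + w`. -/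
theorem XAddW_dvd_coeff_toTorus (x : UqSl4Plus K (q : K)) (i j : ℤ) (hi : i < 0) :
    XAddW q ∣ (toTorus q x).coeff (ofAdd (i, j)) := by
  let P : Submodule K (UqSl4Plus K (q : K)) :=
    { carrier := {x | ∀ i j : ℤ, i < 0 → XAddW q ∣ (toTorus q x).coeff (ofAdd (i, j))}
      add_mem' := fun {x y} hx hy i j hi => by
        rw [map_add, SkewMonoidAlgebra.coeff_add]
        exact dvd_add (hx i j hi) (hy i j hi)
      zero_mem' := fun i j hi => by
        rw [map_zero]
        exact dvd_zero _
      smul_mem' := fun c x hx i j hi => by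
        rw [map_smul, SkewMonoidAlgebra.coeff_smul]
        exact dvd_smul_of_dvd c (hx i j hi) }
  refine mem_of_mul_e_mem (P := P) ?_ ?_ x i j hi
  · intro i j hi
    have h : (1 : Multiplicative (ℤ × ℤ)) ≠ ofAdd (i, j) := by
      intro h
      have h2 : (0 : ℤ) = i := congrArg (fun t => t.toAdd.1) h
      lia
    rw [map_one, SkewMonoidAlgebra.coeff_one, Finsupp.single_eq_of_ne' h]
    exact dvd_zero _
  · intro p hp l i j hi
    have key (n : ℕ) (v : ℤ × ℤ × ℤ) (a b : ℤ) (ha : i - a < 0) :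
        XAddW q ∣ (toTorus q p * tmon q n v (a, b)).coeff (ofAdd (i, j)) := by
      rw [coeff_mul_tmon]
      exact dvd_smul_of_dvd _ (Dvd.dvd.mul_right (hp (i - a) (j - b) ha) _)
    rw [map_mul, toTorus_e]
    fin_cases l
    · change XAddW q ∣ (toTorus q p * (tmon q 0 (-1, 0, 0) (1, 0)
        + tmon q 0 (-1, 0, 0) (0, 1))).coeff (ofAdd (i, j))
      rw [mul_add, SkewMonoidAlgebra.coeff_add]
      exact dvd_add (key _ _ _ _ (by lia)) (key _ _ _ _ (by lia))
    · exact key _ _ _ _ (by lia)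
    · change XAddW q ∣ (toTorus q p *
        ((q : K) • (tmon q 1 (-1, 0, 0) (-1, 0) + tmon q 0 (-1, 1, 0) (-1, 0))
          + (q : K)⁻¹ • ((q : K) ^ 2 • tmon q 1 (-1, 0, 0) (0, -1)
            + tmon q 0 (-1, 0, 1) (0, -1)))).coeff (ofAdd (i, j))
      simp only [mul_add, mul_smul_comm, SkewMonoidAlgebra.coeff_add,
        SkewMonoidAlgebra.coeff_smul]
      refine dvd_add (dvd_smul_of_dvd _ ?_) (dvd_smul_of_dvd _ (dvd_add (dvd_smul_of_dvd _
        (key _ _ _ _ (by lia))) (key _ _ _ _ (by lia))))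
      -- for `i = -1` there is no information on `p`, but the terms with `g⁻¹` combine to `X + w`
      rcases lt_or_eq_of_le (show i + 1 ≤ 0 by lia) with hi' | hi'
      · exact dvd_add (key _ _ _ _ (by lia)) (key _ _ _ _ (by lia))
      · obtain rfl : i = -1 := by lia
        change XAddW q ∣ (toTorus q p * tmon q 1 (-1, 0, 0) (-1, 0)).coeff (ofAdd (-1, j))
          + (toTorus q p * tmon q 0 (-1, 1, 0) (-1, 0)).coeff (ofAdd (-1, j))
        have e : ofAdd ((-1 : ℤ), j) * (ofAdd ((-1 : ℤ), (0 : ℤ)))⁻¹ = ofAdd (0, j) := by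
          rw [← ofAdd_neg, ← ofAdd_add]
          simp
        have hw : weight (0, j) (-1, 0, 0) = weight (0, j) (-1, 1, 0) := by simp [weight]
        rw [coeff_mul_tmon, coeff_mul_tmon, e, toAdd_ofAdd, hw, ← smul_add, ← mul_add]
        have h := monomial_add_monomial_eq (q := q) (-1, 0, 0)
        have e2 : ((-1, 0, 0) + (0, 1, 0) : ℤ × ℤ × ℤ) = (-1, 1, 0) := rfl
        rw [e2] at h
        rw [h]
        exact dvd_smul_of_dvd _ (Dvd.dvd.mul_left (Dvd.intro_left _ rfl) _)

/-- The element `w d - q⁻¹ h X` is divisible by `X + w` and is scaled by the group, hence it is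
divisible by all `X + q ^ (2 n) w`; as these are infinitely many linear factors, it vanishes. -/
theorem X_dvd_of_XAddW_dvd (hq : ∀ n : ℕ, 0 < n → (q : K) ^ n ≠ 1)
    {d h : Polynomial (LaurentRing K q)} (hd : ofAdd ((1 : ℤ), (0 : ℤ)) • d = d)
    (hh : ofAdd ((1 : ℤ), (0 : ℤ)) • h = (q : K) ^ 2 • h) (hdvd : XAddW q ∣ d + (q : K)⁻¹ • h) :
    Polynomial.X ∣ d := by
  set g : Multiplicative (ℤ × ℤ) := ofAdd ((1 : ℤ), (0 : ℤ)) with hg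
  set w : LaurentRing K q := mon q (0, 1, 0) with hw
  have hw0 : w ≠ 0 := by
    intro h
    have h2 := coeffAt_mon (q := q) (0, 1, 0) (0, 1, 0)
    rw [← hw, h, map_zero, if_pos rfl] at h2
    exact zero_ne_one h2
  have hgw : g • w = (q : K) ^ 2 • w := by
    rw [LaurentRing.smul_def, hw, act_mon]
    rfl
  set Y := Polynomial.C w * d - (q : K)⁻¹ • (h * Polynomial.X) with hY
  have hgY : g • Y = (q : K) ^ 2 • Y := by
    rw [hY, smul_sub, smul_mul', Polynomial.smul_C, hgw, hd, smul_comm g, smul_mul', hh,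
      Polynomial.smul_X, ← Polynomial.smul_C, smul_mul_assoc, smul_mul_assoc, smul_sub,
      smul_comm ((q : K)⁻¹)]
  have hgYn (n : ℕ) : g ^ n • Y = ((q : K) ^ 2) ^ n • Y := by
    induction n with
    | zero => simp
    | succ n ih => rw [pow_succ', mul_smul, ih, smul_comm, hgY, smul_smul, ← pow_succ]
  have hgwn (n : ℕ) : g ^ n • w = ((q : K) ^ 2) ^ n • w := by
    induction n with
    | zero => simp
    | succ n ih => rw [pow_succ', mul_smul, ih, smul_comm, hgw, smul_smul, ← pow_succ]
  have hYdvd : XAddW q ∣ Y := by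
    have e : Y = Polynomial.C w * (d + (q : K)⁻¹ • h) - XAddW q * ((q : K)⁻¹ • h) := by
      rw [hY, XAddW, mul_add, add_mul, mul_smul_comm, mul_smul_comm, mul_comm h]
      abel
    rw [e]
    exact dvd_sub (Dvd.dvd.mul_left hdvd _) (dvd_mul_right _ _)
  have hroot (n : ℕ) : Y.IsRoot (-(((q : K) ^ 2) ^ n • w)) := by
    obtain ⟨z, hz⟩ := hYdvd
    have h1 := hgYn n
    rw [hz, smul_mul', ← hz, XAddW, smul_add, Polynomial.smul_X, Polynomial.smul_C, ← hw,
      hgwn] at h1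
    have h2 := congrArg (Polynomial.eval (-(((q : K) ^ 2) ^ n • w))) h1
    rw [Polynomial.eval_mul, Polynomial.eval_add, Polynomial.eval_X, Polynomial.eval_C,
      neg_add_cancel, zero_mul, Polynomial.eval_smul] at h2
    exact (smul_eq_zero.1 h2.symm).resolve_left (pow_ne_zero _ (pow_ne_zero _ q.ne_zero))
  have hinj : Function.Injective fun n : ℕ => -(((q : K) ^ 2) ^ n • w) := by
    intro a b hab
    have h1 : ((q : K) ^ 2) ^ a = ((q : K) ^ 2) ^ b := smul_left_injective K hw0 (neg_injective hab)
    have h2 : ¬ IsOfFinOrder q := by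
      rw [isOfFinOrder_iff_pow_eq_one]
      rintro ⟨n, hn, h⟩
      exact hq n hn (by rw [← Units.val_pow_eq_pow_val, h, Units.val_one])
    have h3 : q ^ (2 * a) = q ^ (2 * b) := Units.ext (by
      rw [Units.val_pow_eq_pow_val, Units.val_pow_eq_pow_val, pow_mul, pow_mul, h1])
    have h4 := (injective_pow_iff_not_isOfFinOrder.2 h2) h3
    lia
  have hY0 : Y = 0 := Polynomial.eq_zero_of_infinite_isRoot Y
    ((Set.infinite_range_of_injective hinj).mono (by rintro _ ⟨n, rfl⟩; exact hroot n))
  have h0 : Y.coeff 0 = 0 := by rw [hY0, Polynomial.coeff_zero]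
  rw [hY, Polynomial.coeff_sub, Polynomial.coeff_C_mul, Polynomial.coeff_smul,
    Polynomial.coeff_mul_X_zero, smul_zero, sub_zero] at h0
  exact Polynomial.X_dvd_iff.2 ((mul_eq_zero.1 h0).resolve_left hw0)

end Coefficients

end SkewTorus

section Derivations

open SkewTorus LaurentRing UqSl4Plus Multiplicative

theorem commute_of_commute_smul {K A : Type*} [Field K] [Ring A] [Algebra K A] {c : K}
    (hc : c ≠ 0) {x y : A} (h : Commute x (c • y)) : Commute x y :=
  (Commute.smul_right_iff₀ hc).1 h

theorem IsAlgDerivation.map_mem_center {K A : Type*} [Field K] [Ring A] [Algebra K A]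
    {D : A →ₗ[K] A} (hD : IsAlgDerivation D) {z : A} (hz : z ∈ Subalgebra.center K A) :
    D z ∈ Subalgebra.center K A := by
  rw [Subalgebra.mem_center_iff] at hz ⊢
  intro b
  have h := congrArg D (hz b)
  rw [hD, hD, hz (D b), add_comm] at h
  exact add_right_cancel h

variable {K : Type*} [Field K] {q : Kˣ}

/-- Only the coefficient of the image of the central element `D(Δ_2)` at the neutral element of
`ℤ²` survives. Differentiating `X_2 W = q ^ 2 W X_2` and `X_5 X_2 = Δ_2 + q⁻¹ W` with `W = X_3 X_4`
and comparing coefficients shows that `X_dvd_of_XAddW_dvd` applies to it. -/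
theorem exists_derivation_Delta2_eq (hq : ∀ n : ℕ, 0 < n → (q : K) ^ n ≠ 1)
    {D : UqSl4Plus K (q : K) →ₗ[K] UqSl4Plus K (q : K)} (hD : IsAlgDerivation D) :
    ∃ z ∈ Subalgebra.center K (UqSl4Plus K (q : K)), D (Delta2 K q) = z * Delta2 K q := by
  have hq2 : (q : K) ^ 2 ≠ 1 := hq 2 (by norm_num)
  have hq4 : (q : K) ^ 2 + 1 ≠ 0 := by
    intro h
    refine hq 4 (by norm_num) ?_
    linear_combination ((q : K) ^ 2 - 1) * h
  have hν := sub_inv_ne_zero hq2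
  have hDc := Subalgebra.mem_center_iff.1 (hD.map_mem_center (Delta2_mem_center hq2 hq4))
  set g : Multiplicative (ℤ × ℤ) := ofAdd ((1 : ℤ), (0 : ℤ)) with hg
  obtain ⟨W, hW⟩ : ∃ W : UqSl4Plus K (q : K), W = X3 K (q : K) * X4 K q := ⟨_, rfl⟩
  set ν : K := (q : K) - (q : K)⁻¹ with hνdef
  set x := toTorus q (D (Delta2 K q)) with hx
  have hφW : toTorus q W = (ν ^ 2 * q) • tmon q 0 (0, 1, 0) 0 := by
    rw [hW, map_mul, toTorus_X3, toTorus_X4, smul_mul_assoc, tmon_mul_tmon]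
    simp [weight, hνdef]
  have hcomm (y : UqSl4Plus K (q : K)) : Commute x (toTorus q y) := by
    rw [commute_iff_eq, hx, ← map_mul, ← map_mul, hDc]
  have hcW : Commute x (tmon q 0 (0, 1, 0) 0) := by
    have h := hcomm W
    rw [hφW] at h
    exact commute_of_commute_smul (mul_ne_zero (pow_ne_zero 2 hν) q.ne_zero) h
  have hc4 : Commute x (tmon q 0 (1, 0, 0) 0) := toTorus_X4 (q := q) ▸ hcomm (X4 K q)
  have hc2 : Commute x (tmon q 0 0 (1, 0)) := by
    have h := hcomm (X2 K q)
    rw [toTorus_X2] at h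
    exact commute_of_commute_smul hν h
  -- `W` sees the first component of `t`, and `X_4` the difference of the two components
  have hoff (t : ℤ × ℤ) (ht : t ≠ 0) : x.coeff (ofAdd t) = 0 := by
    by_contra hne
    have h1 := weight_eq_zero_of_commute hq hcW hne
    have h2 := weight_eq_zero_of_commute hq hc4 hne
    simp only [weight] at h1 h2
    exact ht (Prod.ext (by simp; lia) (by simp; lia))
  have hd : g • x.coeff 1 = x.coeff 1 := by
    have h := congrArg (fun s => SkewMonoidAlgebra.coeff s g) hc2.eq
    simp only [coeff_tmon_mul, coeff_mul_tmon, ← hg, inv_mul_cancel, mul_inv_cancel, mon_zero,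
      Polynomial.monomial_zero_one] at h
    simpa [weight] using h.symm
  set H := toTorus q (D W) with hH
  set s := toTorus q (D (X2 K q)) with hs
  -- the coefficient at `g` of the differentiated relation `X_2 W = q ^ 2 W X_2`
  have hh : g • H.coeff 1 = (q : K) ^ 2 • H.coeff 1 := by
    have h := congrArg (fun a => toTorus q (D a)) (X2_mul_X3_mul_X4 (K := K) q.ne_zero hq4)
    simp only [← hW, map_smul] at h
    rw [hD, hD, map_add, map_add, map_mul, map_mul, map_mul, map_mul, hφW, toTorus_X2, ← hs,
      ← hH, ← hνdef] at h
    have h' := congrArg (fun a => SkewMonoidAlgebra.coeff a g) h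
    have hw : ((q ^ weight g.toAdd (0, 1, 0) : Kˣ) : K) = (q : K) ^ 2 := rfl
    simp only [SkewMonoidAlgebra.coeff_add, SkewMonoidAlgebra.coeff_smul, mul_smul_comm,
      smul_mul_assoc, Finsupp.coe_add, Finsupp.coe_smul, Pi.add_apply, Pi.smul_apply,
      coeff_tmon_mul, coeff_mul_tmon, ← hg, inv_mul_cancel, mul_inv_cancel, mon_zero, weight_zero,
      Polynomial.monomial_zero_one, ofAdd_zero, inv_one, mul_one, one_mul, one_smul, zpow_zero,
      Units.val_one, hw, mul_comm (Polynomial.monomial 0 (mon q (0, 1, 0)))] at h'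
    refine smul_right_injective (Polynomial (LaurentRing K q)) hν ?_
    generalize g • H.coeff 1 = h1 at h' ⊢
    linear_combination (norm := module) h'
  -- the coefficient at `1` of the differentiated relation `X_5 X_2 = Δ_2 + q⁻¹ W`
  have hdvd : XAddW q ∣ x.coeff 1 + (q : K)⁻¹ • H.coeff 1 := by
    have h := congrArg (fun a => toTorus q (D a)) (X5_mul_X2 (K := K) q.ne_zero hq4)
    simp only [← hW, map_smul, map_add] at h
    rw [hD, map_add, map_mul, map_mul, toTorus_X2, toTorus_X5, ← hs, ← hH, ← hx, ← hνdef] at h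
    have h' := congrArg (fun a => SkewMonoidAlgebra.coeff a 1) h
    have hinv : (ofAdd ((1 : ℤ), (0 : ℤ)))⁻¹ = ofAdd (-1, 0) := rfl
    have hsum := monomial_add_monomial_eq (q := q) 0
    rw [zero_add] at hsum
    simp only [SkewMonoidAlgebra.coeff_add, SkewMonoidAlgebra.coeff_smul, mul_smul_comm,
      smul_mul_assoc, Finsupp.coe_add, Finsupp.coe_smul, Pi.add_apply, Pi.smul_apply, add_mul,
      coeff_tmon_mul, coeff_mul_tmon, hinv, one_mul] at h'
    rw [← add_mul, hsum] at h'
    rw [← h']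
    exact dvd_add (dvd_smul_of_dvd _ (dvd_smul_of_dvd _
        (Dvd.dvd.mul_right (XAddW_dvd_coeff_toTorus _ _ _ (by norm_num)) _)))
      (dvd_smul_of_dvd _ (Dvd.dvd.mul_right (Dvd.intro_left _ rfl) _))
  have hX : Polynomial.X ∣ x.coeff 1 := X_dvd_of_XAddW_dvd hq hd hh hdvd
  obtain ⟨z, hz⟩ := exists_eq_Delta2_mul hq2 hq4 (x := D (Delta2 K q)) (fun t => by
    by_cases ht : t = 1
    · rw [ht]; exact hX
    · have h := hoff t.toAdd ht
      rw [ofAdd_toAdd] at h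
      rw [← hx, h]
      exact dvd_zero _)
  have hΔ := Subalgebra.mem_center_iff.1 (Delta2_mem_center (K := K) hq2 hq4)
  refine ⟨z, Subalgebra.mem_center_iff.2 fun b => Delta2_mul_cancel hq2 hq4 ?_, ?_⟩
  · have h := hDc b
    rw [hz, mul_assoc, ← mul_assoc b, hΔ b, mul_assoc] at h
    exact h
  · rw [hz, hΔ z]

/-- The two-sided ideal generated by a central element consists of its multiples. -/
theorem exists_mul_of_mem_twoSidedIdeal_span {A : Type*} [Ring A] {z : A}
    (hz : ∀ b, b * z = z * b) {a : A} (ha : a ∈ TwoSidedIdeal.span {z}) : ∃ b, a = z * b := by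
  induction ha using TwoSidedIdeal.span_induction with
  | mem x hx => exact ⟨1, by rw [Set.mem_singleton_iff.1 hx, mul_one]⟩
  | zero => exact ⟨0, (mul_zero z).symm⟩
  | add x y _ _ hx hy =>
    obtain ⟨b, rfl⟩ := hx
    obtain ⟨c, rfl⟩ := hy
    exact ⟨b + c, (mul_add z b c).symm⟩
  | neg x _ hx =>
    obtain ⟨b, rfl⟩ := hx
    exact ⟨-b, (mul_neg z b).symm⟩
  | left_absorb a x _ hx =>
    obtain ⟨b, rfl⟩ := hx
    exact ⟨a * b, by rw [← mul_assoc, hz, mul_assoc]⟩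
  | right_absorb a x _ hx =>
    obtain ⟨b, rfl⟩ := hx
    exact ⟨b * a, by rw [mul_assoc]⟩

theorem UqSl4Plus.Delta2_mem_homogeneousPart (q : K) :
    Delta2 K q ∈ homogeneousPart K q 4 := by
  set V := Submodule.span K (Set.range (e K q)) with hV
  have he (i : Fin 3) : e K q i ∈ V ^ 1 := by
    rw [pow_one]
    exact Submodule.subset_span ⟨i, rfl⟩
  have hmul {m n : ℕ} {x y : UqSl4Plus K q} (hx : x ∈ V ^ m) (hy : y ∈ V ^ n) :
      x * y ∈ V ^ (m + n) := by
    rw [pow_add]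
    exact Submodule.mul_mem_mul hx hy
  have h2 : X2 K q ∈ V ^ 2 :=
    sub_mem (hmul (he 0) (he 1)) (Submodule.smul_mem _ _ (hmul (he 1) (he 0)))
  have h5 : X5 K q ∈ V ^ 2 :=
    sub_mem (hmul (he 1) (he 2)) (Submodule.smul_mem _ _ (hmul (he 2) (he 1)))
  have h3 : X3 K q ∈ V ^ 3 :=
    sub_mem (hmul (he 0) h5) (Submodule.smul_mem _ _ (hmul h5 (he 0)))
  exact sub_mem (hmul h2 h5) (Submodule.smul_mem _ _ (hmul h3 (he 1)))

end Derivations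

theorem theoremT {K : Type*} [Field K] [CharZero K] (q : K) (hq0 : q ≠ 0)
    (hq : ∀ n : ℕ, 0 < n → q ^ n ≠ 1) :
    (UqSl4Plus.Delta2 K q ∈ Subalgebra.center K (UqSl4Plus K q) ∧
      UqSl4Plus.Delta2 K q ∈ UqSl4Plus.homogeneousPart K q 4 ∧
      UqSl4Plus.Delta2 K q ≠ 0) ∧
    ∀ D : UqSl4Plus K q →ₗ[K] UqSl4Plus K q, IsAlgDerivation D →
      (∃ z ∈ Subalgebra.center K (UqSl4Plus K q),
        D (UqSl4Plus.Delta2 K q) = z * UqSl4Plus.Delta2 K q) ∧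
      ∀ a ∈ TwoSidedIdeal.span {UqSl4Plus.Delta2 K q},
        D a ∈ TwoSidedIdeal.span {UqSl4Plus.Delta2 K q} := by
  have hq2 : q ^ 2 ≠ 1 := hq 2 (by norm_num)
  have hq4 : q ^ 2 + 1 ≠ 0 := by
    intro h
    refine hq 4 (by norm_num) ?_
    linear_combination (q ^ 2 - 1) * h
  obtain ⟨q, rfl⟩ : ∃ u : Kˣ, (u : K) = q := ⟨Units.mk0 q hq0, rfl⟩
  have hc := SkewTorus.Delta2_mem_center hq2 hq4
  refine ⟨⟨hc, UqSl4Plus.Delta2_mem_homogeneousPart _, SkewTorus.Delta2_ne_zero hq2⟩,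
    fun D hD => ?_⟩
  obtain ⟨z, hz, hDz⟩ := exists_derivation_Delta2_eq hq hD
  refine ⟨⟨z, hz, hDz⟩, fun a ha => ?_⟩
  obtain ⟨b, rfl⟩ := exists_mul_of_mem_twoSidedIdeal_span (Subalgebra.mem_center_iff.1 hc) ha
  have hmem : UqSl4Plus.Delta2 K (q : K) ∈ TwoSidedIdeal.span {UqSl4Plus.Delta2 K (q : K)} :=
    TwoSidedIdeal.subset_span rfl
  rw [hD, hDz]
  exact add_mem (TwoSidedIdeal.mul_mem_right _ _ _ (TwoSidedIdeal.mul_mem_left _ _ _ hmem))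
    (TwoSidedIdeal.mul_mem_right _ _ _ hmem)
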